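/- **Setting.** Let $\mathsf{PLA}$ be a passwordless authentication scheme (key generation $\mathsf{Gen}$; server challenges $(id_S, rs)$, client commands, token responses and server checks, for registration and for authentication). FIDO-AC is the scheme with attributes and mediator that is built from $\mathsf{PLA}$, a signature scheme of the mediator, an eID infrastructure, a non-interactive argument system $(\mathsf{ZKSetup},\mathsf{ZKProve},\mathsf{ZKVer})$ with simulators $(\mathcal{SIM}_1,\mathcal{SIM}_2)$, and a hash function $H:\{0,1\}^*\to\{0,1\}^n$ modelled as a random oracle. Issued eID data groups $DG$ encode exactly the attributes they are issued for, and honest passive and chip authentication always succeed. On a challenge with policy $((id,rs),P)$ the client picks a nonce in $\{0,1\}^\lambda$ and obtains from the mediator $att=H(H(DG)\|nonce)\|(id,rs)$ with a signature $\sigma$ (signed if passive and chip authentication are accepted). It sets $\pi\leftarrow\mathsf{ZKProve}(crs,(m,P),(DG,nonce))$ with $m=H(H(DG)\|nonce)$, or $\pi=\bot$ if the attributes in $DG$ do not contain $P$. With $\Pi=(att,\sigma,\pi)$, the $\mathsf{PLA}$ client and token are run on the challenge $(id,rs\|H(\Pi))$, and $\Pi$ is sent along. The server runs the $\mathsf{PLA}$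 check on $(id,rs\|H(\Pi))$ and checks $\sigma$, $\pi$ and that $att$ contains its challenge $(id,rs)$. The proved relation is $((m,P),(DG,nonce))$ with $m=H(H(DG)\|nonce)$ and $P\subseteq \mathrm{Att}(DG)$. The argument system and its simulators may query $H$, each simulator at most as often as the bound set for the honest algorithm it replaces. **Unlinkability experiment for $m$ tokens.** Token keys (and, for FIDO-AC, a common reference string and mediator keys) are generated. For FIDO-AC the adversary sets the policies $\mathsf{Policy}_S$ of the servers and the attributes $\mathsf{Att}_T$ of the tokens, and every token gets a fresh eID with its attributes. * *Phase 1.* The adversary queries $\mathsf{Start}(\pi_S^{i,j})$, $\mathsf{Challenge}(\pi_T^{i,j},id_S,cid,M)$ and $\mathsf{Complete}(\pi_S^{i,j},cid,R)$, each at most once per handle ($j=0$ is registration, $j\ge1$ authentication). For FIDO-AC it also queries $H$ and the mediator oracles (attestation request of a token, mediator challenge, response of a token, attestation), and it may have $\mathsf{Challenge}$ run the client part on a challenge with policy. * *Phase 2.* It chooses tokens $T_0,T_1$ and servers $S_L,S_R$; for FIDO-AC, such that $\mathsf{Att}_{T_0}\supseteq\mathsf{Policy}_S\iff\mathsf{Att}_{T_1}\supseteq\mathsf{Policy}_S$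 for $S\in\{S_L,S_R\}$. A uniform bit $b$ is drawn, and $i_u$ is the least $i$ such that $\pi_{T_u}^{i,0}$ was not queried. * *Phase 3.* It may also query $\mathsf{Left}(cid,M)$, which runs $T_b$ for $S_L$ in the instances $\pi_{T_b}^{i_b,0},\pi_{T_b}^{i_b,1},\dots$, and $\mathsf{Right}(cid,M)$, which runs $T_{1-b}$ for $S_R$ likewise. For FIDO-AC these may also run the client part (with the eID of the token that is run), and they refuse if the policy of the input is not that of $S_L$, resp. $S_R$. The adversary outputs $\hat b$. The experiment returns $1$ iff $\hat b=b$, no handle $\pi_{T_u}^{i_u,k}$ with $u\in\{0,1\}$ was ever queried to $\mathsf{Challenge}$, and the level $x$ of credential separation holds. For the latter let $\mathcal L^r_{ch}$ be the $cid$s returned by registration queries and $\mathcal L^a_{ch}$ those input to authentication queries to $\mathsf{Challenge}$ for $T_0$ or $T_1$ and $S_L$ or $S_R$, and let $\mathcal L^r_{lr},\mathcal L^a_{lr}$ be the corresponding lists for $\mathsf{Left}$ and $\mathsf{Right}$. The following set must be empty: $$\mathbf w:\ (\mathcal L^r_{ch}\cup\mathcal L^a_{ch})\cap(\mathcal L^r_{lr}\cup\mathcal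 L^a_{lr}),\qquad \mathbf m:\ ((\mathcal L^r_{ch}\cup\mathcal L^a_{ch})\cap\mathcal L^a_{lr})\cup((\mathcal L^r_{lr}\cup\mathcal L^a_{lr})\cap\mathcal L^a_{ch}),\qquad \mathbf s:\ (\mathcal L^r_{ch}\cap\mathcal L^a_{lr})\cup(\mathcal L^r_{lr}\cap\mathcal L^a_{ch}).$$ The advantage $\mathrm{Adv}_{x}$ is $|\Pr[\text{experiment}=1]-1/2|$. The zero-knowledge advantage $\mathsf{ZK}^{\mathcal B}$ is the difference, in absolute value, of the probabilities that $\mathcal B$, given $crs$, submits one pair $(stmt,wit)$ in the relation and outputs $1$ after receiving a proof, where $crs$ and proof come from $\mathsf{ZKSetup},\mathsf{ZKProve}$ in one case and from $\mathcal{SIM}_1,\mathcal{SIM}_2$ in the other; $\mathcal B$ may query $H$. **Theorem.** Let $x\in\{\mathbf w,\mathbf m,\mathbf s\}$ and let $\mathcal A$ be an adversary against the unlinkability of FIDO-AC. Let $q_L$, $q_R$ bound the numbers of its queries to $\mathsf{Left}$, $\mathsf{Right}$, and let $q_H$ bound the number of all random oracle queries in the experiment, by $\mathcal A$ or by the algorithms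 of the experiment. Then in the random oracle model $$\mathrm{Adv}_{x,\text{FIDO-AC}}^{\mathcal A}\ \le\ \mathrm{Adv}_{x,\mathsf{PLA}}^{\mathcal R}+(q_L+q_R)\cdot\Big(\frac{q_H}{2^{\lambda}}+\mathsf{ZK}^{\mathcal B}\Big).$$ Here $\mathcal R$ and $\mathcal B$ are explicit black-box adversaries obtained from $\mathcal A$. Each runs $\mathcal A$ once and otherwise only runs the algorithms of the schemes and samples the random oracle, a constant number of times per query of $\mathcal A$ plus a setup that is linear in the number of tokens. $\mathcal R$ forwards each query to $\mathsf{Challenge},\mathsf{Left},\mathsf{Right}$ to at most one query to the oracle of that name in the $\mathsf{PLA}$ experiment. -/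

import Mathlib

noncomputable section

namespace FidoAC

/-! ### Probabilistic programs with oracle access -/

/-- Probabilistic programs with result in `α` that may query oracles: a query `i : I` is answered by
an element of `O i`; `draw` samples from a discrete distribution. -/
inductive Prog (I : Type) (O : I → Type) (α : Type) : Type 1
  | ret (a : α) : Prog I O α
  | ask (i : I) (k : O i → Prog I O α) : Prog I O α
  | draw {β : Type} (p : PMF β) (k : β → Prog I O α) : Prog I O α

namespace Prog

variable {I J : Type} {O : I → Type} {P : J → Type} {α β τ : Type}

/-- Sequential composition. -/
def bind : Prog I O α → (α → Prog I O β) → Prog I O β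
  | ret a, f => f a
  | ask i k, f => ask i (fun o => (k o).bind f)
  | draw p k, f => draw p (fun x => (k x).bind f)

instance : Monad (Prog I O) where
  pure := ret
  bind := bind

/-- Ask one oracle query. -/
def query (i : I) : Prog I O (O i) := ask i ret

/-- Sample from a distribution. -/
def sample (p : PMF α) : Prog I O α := draw p ret

/-- Run a program, answering its queries by the stateful implementation `h`, which may itself query
further oracles. -/
def sim (h : (i : I) → τ → Prog J P (O i × τ)) : Prog I O α → τ → Prog J P (α × τ)
  | ret a, s => ret (a, s)
  | ask i k, s => (h i s).bind (fun r => (k r.1).sim h r.2)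
  | draw p k, s => draw p (fun x => (k x).sim h s)

/-- Run a program, answering its queries by the stateless implementation `h`. -/
def via (h : (i : I) → Prog J P (O i)) : Prog I O α → Prog J P α
  | ret a => ret a
  | ask i k => (h i).bind (fun r => (k r).via h)
  | draw p k => draw p (fun x => (k x).via h)

/-- `p.Spends c n post`: in every execution of `p`, whatever the oracles answer, the queries asked
(where query `i` costs `c i`) cost at most `n`, and the result and the remaining budget satisfy
`post`. -/
def Spends (c : I → ℕ) : Prog I O α → ℕ → (α → ℕ → Prop) → Prop
  | ret a, n, post => post a n
  | ask i k, n, post => c i ≤ n ∧ ∀ o, (k o).Spends c (n - c i) post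
  | draw p k, n, post => ∀ x ∈ p.support, (k x).Spends c n post

/-- The total cost of the queries of `p` is at most `n`. -/
def AtMost (c : I → ℕ) (p : Prog I O α) (n : ℕ) : Prop := p.Spends c n (fun _ _ => True)

/-- Draw `m` independent samples. -/
def replicate : (m : ℕ) → (Fin m → Prog I O α) → Prog I O (Fin m → α)
  | 0, _ => ret Fin.elim0
  | m + 1, p => (p 0).bind fun a => (replicate m (fun i => p i.succ)).bind fun f =>
      ret (Fin.cons a f)

end Prog

/-- Programs without oracles. -/
abbrev Rand (α : Type) : Type 1 := Prog Empty (fun _ => Empty) α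

/-- The output distribution of a program without oracles. -/
def Rand.toPMF {α : Type} : Rand α → PMF α
  | .ret a => PMF.pure a
  | .ask i _ => i.elim
  | .draw p k => p.bind (fun x => Rand.toPMF (k x))

/-- The probability that an experiment returns `1`. -/
def Rand.prTrue (p : Rand Bool) : ℝ := (p.toPMF true).toReal

/-! ### The random oracle -/

abbrev Digest (n : ℕ) : Type := Fin n → Bool
abbrev Nonce (lam : ℕ) : Type := Fin lam → Bool

/-- Programs with access to a hash function `{0,1}* → {0,1}ⁿ`. -/
abbrev RO (n : ℕ) (α : Type) : Type 1 := Prog (List Bool) (fun _ => Digest n) α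

/-- A partially determined hash function. -/
abbrev Table (n : ℕ) : Type := List Bool → Option (Digest n)

/-- Lazy sampling of a uniformly random hash function. -/
def lazyHash {J : Type} {P : J → Type} {n : ℕ} (x : List Bool) (t : Table n) :
    Prog J P (Digest n × Table n) :=
  match t x with
  | some y => .ret (y, t)
  | none => .draw (PMF.uniformOfFintype (Digest n)) (fun y =>
      .ret (y, Function.update t x (some y)))

/-- Run an experiment with a random oracle. -/
def RO.exec {n : ℕ} {α : Type} (p : RO n α) : Rand α :=
  (p.sim lazyHash (fun _ => none)).bind (fun r => .ret r.1)

/-! ### Passwordless authentication (`PLA`) -/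

section PLA

open scoped Classical

/-- A passwordless authentication scheme. `Srv` is the set of servers, a server being identified
with its identity. A server challenge is a pair `(id, rs)` of the server identity and a random
string, and it is also the server's state. -/
structure PLA (Srv : Type) where
  Msk : Type
  Cid : Type
  Cred : Type
  Msg : Type
  Resp : Type
  gen : PMF Msk
  rchallenge : Srv → PMF (List Bool)
  rcommand : Srv → Srv × List Bool → PMF Msg
  rresponse : Msk → Srv → Msg → PMF (Cid × Resp)
  rcheck : Srv × List Bool → Cid → Resp → PMF (Bool × Cred)
  achallenge : Srv → PMF (List Bool)
  acommand : Srv → Srv × List Bool → PMF Msg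
  aresponse : Msk → Srv → Cid → Msg → PMF Resp
  acheck : Srv × List Bool → (Cid → Option Cred) → Cid → Resp → PMF Bool

variable {Srv : Type}

/-- What a token answers: `(some cid, R)` at registration, `(none, R)` at authentication. -/
abbrev PLA.TokenResp (P : PLA Srv) : Type := Option P.Cid × P.Resp

/-- The token algorithm in instance `(i, j)`: registration if `j = 0`, else authentication. -/
def PLA.respond (P : PLA Srv) (k : P.Msk) (j : ℕ) (id : Srv) (cid : P.Cid) (M : P.Msg) :
    PMF P.TokenResp :=
  if j = 0 then (P.rresponse k id M).map (fun r => (some r.1, r.2))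
  else (P.aresponse k id cid M).map (fun r => (none, r))

/-- The client algorithm, for registration if `j = 0`, else for authentication. -/
def PLA.command (P : PLA Srv) (j : ℕ) (id : Srv) (c : Srv × List Bool) : PMF P.Msg :=
  if j = 0 then P.rcommand id c else P.acommand id c

/-- The random string of a server challenge. -/
def PLA.challenge (P : PLA Srv) (j : ℕ) (id : Srv) : PMF (List Bool) :=
  if j = 0 then P.rchallenge id else P.achallenge id

/-- The choice made in Phase 2: tokens `T₀, T₁` (`T false`, `T true`) and servers `S_L, S_R`
(`S false`, `S true`). The Boolean `side` is `false` for `Left` and `true` for `Right`. -/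
structure Target (m : ℕ) (Srv : Type) where
  T : Bool → Fin m
  S : Bool → Srv

/-- The oracles that run a token: `Challenge(π_T^{i,j}, id, cid, M)`, and `Left(cid, M)`,
`Right(cid, M)`. -/
inductive TokenQuery (P : PLA Srv) (m : ℕ) : Type
  | challenge (T : Fin m) (i j : ℕ) (id : Srv) (cid : P.Cid) (M : P.Msg)
  | lr (side : Bool) (cid : P.Cid) (M : P.Msg)

/-- The state of the tokens in an unlinkability experiment, with the records that the winning
condition refers to. -/
structure TokenState (P : PLA Srv) (m : ℕ) where
  /-- the token keys -/
  msk : Fin m → P.Msk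
  /-- handles `(T, i, j)` that were queried to `Challenge` -/
  used : List (Fin m × ℕ × ℕ)
  /-- `(T, id, cid)` for `cid`s returned by registration queries to `Challenge` -/
  chReg : List (Fin m × Srv × P.Cid)
  /-- `(T, id, cid)` for `cid`s that were input to authentication queries to `Challenge` -/
  chAuth : List (Fin m × Srv × P.Cid)
  /-- the choice of Phase 2 and the secret bit; `none` during Phase 1 -/
  phase2 : Option (Target m Srv × Bool)
  /-- the counters `j₀, j₁` -/
  j : Bool → ℕ
  /-- `cid`s returned by `Left` and `Right` at registration -/
  lrReg : List P.Cid
  /-- `cid`s that were input to `Left` and `Right` at authentication -/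
  lrAuth : List P.Cid

variable {P : PLA Srv} {m : ℕ}

def TokenState.start (k : Fin m → P.Msk) : TokenState P m :=
  ⟨k, [], [], [], none, fun _ => 0, [], []⟩

/-- The token oracles. Every handle can be used only once in `Challenge`; `none` is the answer of an
oracle that refuses. With secret bit `b`, `Left` runs `T_b` and `Right` runs `T_{1-b}`; they do not
answer before Phase 2 is over. -/
def TokenState.answer (q : TokenQuery P m) (s : TokenState P m) :
    PMF (Option P.TokenResp × TokenState P m) :=
  match q with
  | .challenge T i j id cid M =>
      if (T, i, j) ∈ s.used then PMF.pure (none, s)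
      else (P.respond (s.msk T) j id cid M).map fun r =>
        (some r, { s with
          used := (T, i, j) :: s.used
          chReg := match r.1 with
            | some c => (T, id, c) :: s.chReg
            | none => s.chReg
          chAuth := if j = 0 then s.chAuth else (T, id, cid) :: s.chAuth })
  | .lr side cid M =>
      match s.phase2 with
      | none => PMF.pure (none, s)
      | some (tgt, b) =>
          let v := xor b side
          (P.respond (s.msk (tgt.T v)) (s.j v) (tgt.S side) cid M).map fun r =>
            (some r, { s with
              j := Function.update s.j v (s.j v + 1)
              lrReg := match r.1 with
                | some c => c :: s.lrReg
                | none => s.lrReg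
              lrAuth := if s.j v = 0 then s.lrAuth else cid :: s.lrAuth })

/-- The three levels of unlinkability. -/
inductive Level
  | weak
  | medium
  | strong

/-- Credential separation, for a choice `tgt` and the final state of the tokens. -/
def TokenState.Separated (x : Level) (tgt : Target m Srv) (s : TokenState P m) : Prop :=
  let chr : Set P.Cid := {c | ∃ u v, (tgt.T u, tgt.S v, c) ∈ s.chReg}
  let cha : Set P.Cid := {c | ∃ u v, (tgt.T u, tgt.S v, c) ∈ s.chAuth}
  let lrr : Set P.Cid := {c | c ∈ s.lrReg}
  let lra : Set P.Cid := {c | c ∈ s.lrAuth}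
  match x with
  | .weak => (chr ∪ cha) ∩ (lrr ∪ lra) = ∅
  | .medium => ((chr ∪ cha) ∩ lra) ∪ ((lrr ∪ lra) ∩ cha) = ∅
  | .strong => (chr ∩ lra) ∪ (lrr ∩ cha) = ∅

/-- The smallest `i` for which the handle `π_T^{i,0}` is unused. -/
def TokenState.fresh (s : TokenState P m) (T : Fin m) : ℕ := sInf {i | (T, i, 0) ∉ s.used}

/-- Instance freshness; `s₁` is the state at the end of Phase 1 and `s` the final state. -/
def TokenState.Fresh (tgt : Target m Srv) (s₁ s : TokenState P m) : Prop :=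
  ∀ (u : Bool) (k : ℕ), (tgt.T u, s₁.fresh (tgt.T u), k) ∉ s.used

/-- The result of the experiment, when the secret bit is `b` and the adversary outputs `g`. -/
def wins (x : Level) (tgt : Target m Srv) (s₁ s : TokenState P m) (b g : Bool) : Bool :=
  decide (g = b ∧ s₁.Fresh tgt s ∧ s.Separated x tgt)

/-- The tables kept by the servers (`State_S`, `C_S`, `rcs_S`), and which instances were
completed. -/
structure ServerState (Srv St Cid Cred : Type) where
  st : Srv → ℕ → ℕ → Option St
  completed : List (Srv × ℕ × ℕ)
  cid : Srv → ℕ → Option Cid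
  rcs : Srv → Cid → Option Cred

section Server

variable {St Cid Cred R C I : Type} {O : I → Type}

def ServerState.empty : ServerState Srv St Cid Cred :=
  ⟨fun _ _ _ => none, [], fun _ _ => none, fun _ _ => none⟩

/-- The oracle `Start(π_S^{i,j})`, where `gen` outputs the challenge and the state. -/
def ServerState.startOracle (gen : Prog I O (C × St)) (S : Srv) (i j : ℕ)
    (s : ServerState Srv St Cid Cred) : Prog I O (Option C × ServerState Srv St Cid Cred) :=
  if (s.st S i j).isSome then return (none, s)
  else do
    let r ← gen
    return (some r.1, { s with st := fun S' i' j' =>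
      if S' = S ∧ i' = i ∧ j' = j then some r.2 else s.st S' i' j' })

/-- The oracle `Complete(π_S^{i,j}, cid, R)`. -/
def ServerState.completeOracle (rcheck : St → Cid → R → Prog I O (Bool × Cred))
    (acheck : St → (Cid → Option Cred) → Cid → R → Prog I O Bool) (S : Srv) (i j : ℕ) (cid : Cid)
    (r : R) (s : ServerState Srv St Cid Cred) :
    Prog I O (Option Bool × ServerState Srv St Cid Cred) :=
  match s.st S i j with
  | none => return (none, s)
  | some st =>
    if (S, i, j) ∈ s.completed then return (none, s)
    else if j = 0 then do
      let a ← rcheck st cid r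
      return (some a.1, { s with
        completed := (S, i, j) :: s.completed
        cid := fun S' i' => if S' = S ∧ i' = i then some cid else s.cid S' i'
        rcs := fun S' c' => if S' = S ∧ c' = cid then some a.2 else s.rcs S' c' })
    else if s.cid S i ≠ some cid then return (none, s)
    else do
      let a ← acheck st (s.rcs S) cid r
      return (some a, { s with completed := (S, i, j) :: s.completed })

end Server

/-- The oracles of the unlinkability experiment for `PLA`. -/
inductive PLAQuery (P : PLA Srv) (m : ℕ) : Type
  | start (S : Srv) (i j : ℕ)
  | complete (S : Srv) (i j : ℕ) (cid : P.Cid) (r : P.Resp)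
  | token (q : TokenQuery P m)

abbrev PLAQuery.Ans : PLAQuery P m → Type
  | .start _ _ _ => Option (Srv × List Bool)
  | .complete _ _ _ _ _ => Option Bool
  | .token _ => Option P.TokenResp

/-- An adversary against the unlinkability of a `PLA` with `m` tokens: Phase 1 ends with the choice
of Phase 2; Phase 3 ends with the output of a bit. -/
structure PLAAdversary (P : PLA Srv) (m : ℕ) where
  State : Type
  phase1 : Prog (PLAQuery P m) PLAQuery.Ans (Target m Srv × State)
  phase3 : State → Prog (PLAQuery P m) PLAQuery.Ans Bool

abbrev PLA.Servers (P : PLA Srv) : Type := ServerState Srv (Srv × List Bool) P.Cid P.Cred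

def plaOracle : (q : PLAQuery P m) → P.Servers × TokenState P m →
    Rand (q.Ans × P.Servers × TokenState P m)
  | .start S i j, s => do
      let r ← s.1.startOracle (do
        let rs ← Prog.sample (P.challenge j S)
        return ((S, rs), (S, rs))) S i j
      return (r.1, r.2, s.2)
  | .complete S i j cid a, s => do
      let r ← s.1.completeOracle (fun st c a => Prog.sample (P.rcheck st c a))
        (fun st t c a => Prog.sample (P.acheck st t c a)) S i j cid a
      return (r.1, r.2, s.2)
  | .token q, s => do
      let r ← Prog.sample (s.2.answer q)
      return (r.1, s.1, r.2)

/-- The unlinkability experiment for `PLA`. -/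
def plaUnl (x : Level) (A : PLAAdversary P m) : Rand Bool := do
  let msk ← Prog.replicate m (fun _ => Prog.sample P.gen)
  let ((tgt, st), srv₁, s₁) ← A.phase1.sim plaOracle (ServerState.empty, TokenState.start msk)
  let b ← Prog.sample (PMF.uniformOfFintype Bool)
  let (g, _, s) ← (A.phase3 st).sim plaOracle (srv₁, { s₁ with phase2 := some (tgt, b) })
  return wins x tgt s₁ s b g

def plaUnlAdvantage (x : Level) (A : PLAAdversary P m) : ℝ :=
  |(plaUnl x A).prTrue - 1 / 2|

end PLA

/-! ### The other building blocks of FIDO-AC -/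

/-- The message `m ‖ c` signed by the mediator: a digest and a server challenge. -/
abbrev AttMsg (n : ℕ) (Srv : Type) : Type := Digest n × (Srv × List Bool)

/-- A signature scheme for messages in `M`. -/
structure SigScheme (M : Type) where
  VK : Type
  SK : Type
  Sig : Type
  keyGen : PMF (VK × SK)
  sign : SK → M → PMF Sig
  verify : VK → M → Sig → Bool

/-- An eID infrastructure: personalisation of documents, passive authentication (an issuer signature
under the digest of the data groups and the chip key) and chip authentication (key exchange,
encrypted command, response of the chip). `keyGen` generates the mediator's keys. The last three
fields say that issued data groups encode the attributes they were issued for and that honest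
executions of passive and chip authentication succeed. -/
structure EID (n : ℕ) (Attr : Type) {VK SK : Type} (keyGen : PMF (VK × SK)) where
  ChipPK : Type
  ChipSK : Type
  PASig : Type
  SesKey : Type
  Cmd : Type
  CAResp : Type
  /-- the attributes encoded in data groups -/
  attrs : List Bool → Finset Attr
  /-- data groups and chip keys of a fresh document with the given attributes -/
  issue : Finset Attr → PMF (List Bool × ChipPK × ChipSK)
  paSign : Digest n → ChipPK → PMF PASig
  paVerify : Digest n → ChipPK → PASig → Bool
  ke : ChipPK → SK → PMF SesKey
  aeEnc : SesKey → PMF Cmd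
  ca : VK → Cmd → ChipSK → PMF CAResp
  caVerify : CAResp → SesKey → Bool
  attrs_issue : ∀ att, ∀ d ∈ (issue att).support, attrs d.1 = att
  pa_correct : ∀ att, ∀ d ∈ (issue att).support, ∀ h, ∀ p ∈ (paSign h d.2.1).support,
    paVerify h d.2.1 p = true
  ca_correct : ∀ att, ∀ d ∈ (issue att).support, ∀ k ∈ keyGen.support,
    ∀ key ∈ (ke d.2.1 k.2).support, ∀ cmd ∈ (aeEnc key).support,
    ∀ r ∈ (ca k.1 cmd d.2.2).support, caVerify r key = true

/-- Statements `(m, Policy)` of the proof system. -/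
abbrev Stmt (n : ℕ) (Attr : Type) : Type := Digest n × Finset Attr

/-- Witnesses `(DG, nonce)` of the proof system. -/
abbrev Wit (lam : ℕ) : Type := List Bool × Nonce lam

/-- The bit string `h ‖ nonce`. -/
def salted {n lam : ℕ} (h : Digest n) (r : Nonce lam) : List Bool := List.ofFn h ++ List.ofFn r

/-- A non-interactive argument system; the algorithms may query the hash function, the numbers
`qSetup`, `qProve`, `qVer` bound how often. -/
structure NIZK (n lam : ℕ) (Attr : Type) where
  Crs : Type
  Pf : Type
  setup : RO n Crs
  prove : Crs → Stmt n Attr → Wit lam → RO n (Option Pf)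
  verify : Crs → Stmt n Attr → Pf → RO n Bool
  qSetup : ℕ
  qProve : ℕ
  qVer : ℕ
  setup_le : setup.AtMost (fun _ => 1) qSetup
  prove_le : ∀ crs s w, (prove crs s w).AtMost (fun _ => 1) qProve
  verify_le : ∀ crs s p, (verify crs s p).AtMost (fun _ => 1) qVer

/-- A pair of simulator algorithms `(SIM₁, SIM₂)`, with trapdoors in `Td`. -/
structure Simulator {n lam : ℕ} {Attr : Type} (Z : NIZK n lam Attr) where
  Td : Type
  sim1 : RO n (Z.Crs × Td)
  sim2 : Z.Crs → Stmt n Attr → Td → RO n (Option Z.Pf)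
  sim1_le : sim1.AtMost (fun _ => 1) Z.qSetup
  sim2_le : ∀ crs s td, (sim2 crs s td).AtMost (fun _ => 1) Z.qProve

section ZK

variable {n lam : ℕ} {Attr : Type}

open scoped Classical in
/-- The relation `m = H(H(DG) ‖ nonce)` and `Policy ⊆ Att(DG)`. -/
def relation (attrs : List Bool → Finset Attr) (s : Stmt n Attr) (w : Wit lam) : RO n Bool := do
  let h ← Prog.query w.1
  let d ← Prog.query (salted h w.2)
  return decide (s.1 = d ∧ s.2 ⊆ attrs w.1)

/-- A zero-knowledge adversary may query the hash function and submits one pair of a statement and a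
witness, for which it receives a proof. -/
inductive ZKQuery (n lam : ℕ) (Attr : Type) : Type
  | hash (x : List Bool)
  | submit (s : Stmt n Attr) (w : Wit lam)

abbrev ZKQuery.Ans (Pf : Type) : ZKQuery n lam Attr → Type
  | .hash _ => Digest n
  | .submit _ _ => Option Pf

abbrev ZKAdversary (Z : NIZK n lam Attr) : Type 1 :=
  Z.Crs → Prog (ZKQuery n lam Attr) (ZKQuery.Ans Z.Pf) Bool

/-- The state is `none` until a pair was submitted, and then records whether it is in the relation.
Only the first submission counts. -/
def zkOracle {Pf : Type} (attrs : List Bool → Finset Attr)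
    (prover : Stmt n Attr → Wit lam → RO n (Option Pf)) :
    (q : ZKQuery n lam Attr) → Option Bool → RO n (q.Ans Pf × Option Bool)
  | .hash x, v => do
      let y ← Prog.query x
      return (y, v)
  | .submit _ _, some v => return (none, some v)
  | .submit s w, none => do
      let v ← relation attrs s w
      let p ← prover s w
      return (p, some v)

/-- The adversary outputs `1` and the pair it submitted is in the relation. -/
def zkOutcome (r : Bool × Option Bool) : Bool := r.1 && r.2 == some true

def zkReal (Z : NIZK n lam Attr) (attrs : List Bool → Finset Attr) (B : ZKAdversary Z) :
    RO n Bool := do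
  let crs ← Z.setup
  let r ← (B crs).sim (zkOracle attrs (Z.prove crs)) none
  return zkOutcome r

def zkSim (Z : NIZK n lam Attr) (Sm : Simulator Z) (attrs : List Bool → Finset Attr)
    (B : ZKAdversary Z) : RO n Bool := do
  let (crs, td) ← Sm.sim1
  let r ← (B crs).sim (zkOracle attrs (fun s _ => Sm.sim2 crs s td)) none
  return zkOutcome r

/-- The advantage of `B` in breaking the zero-knowledge property, in the random oracle model. -/
def zkAdvantage (Z : NIZK n lam Attr) (Sm : Simulator Z) (attrs : List Bool → Finset Attr)
    (B : ZKAdversary Z) : ℝ :=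
  |(zkReal Z attrs B).exec.prTrue - (zkSim Z Sm attrs B).exec.prTrue|

end ZK

/-! ### The FIDO-AC protocol -/

/-- The mediator's part of a FIDO-AC response: `att_m`, `σ_m` (or `⊥`), `π_zkp` (or `⊥`). -/
abbrev AttProof (n : ℕ) (Srv Sig Pf : Type) : Type := AttMsg n Srv × Option Sig × Option Pf

/-- The components from which FIDO-AC is built. `encode` is the bit string representation of
`Π_Att` that is hashed; `polExt` is the policy extraction function `Pol-Ext`. -/
structure Scheme (n lam : ℕ) (Srv Attr : Type) where
  pla : PLA Srv
  sig : SigScheme (AttMsg n Srv)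
  eid : EID n Attr sig.keyGen
  zk : NIZK n lam Attr
  encode : AttProof n Srv sig.Sig zk.Pf → List Bool
  polExt : pla.Msg → Finset Attr

section Protocol

open scoped Classical

variable {n lam : ℕ} {Srv Attr : Type} (F : Scheme n lam Srv Attr)

/-- The credential `ask_T` of a token: an eID holding its data groups, their digest, the chip keys
and the issuer signature. -/
structure Ask where
  dg : List Bool
  digest : Digest n
  pk : F.eid.ChipPK
  sk : F.eid.ChipSK
  paSig : F.eid.PASig

/-- `req_M = (H(DG), pk_eID, π_PA, c, nonce)`. -/
structure Req where
  digest : Digest n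
  pk : F.eid.ChipPK
  paSig : F.eid.PASig
  c : Srv × List Bool
  nonce : Nonce lam

abbrev Scheme.Proof : Type := AttProof n Srv F.sig.Sig F.zk.Pf
abbrev Scheme.MedSt : Type := Req F × F.eid.SesKey
abbrev Scheme.MedChal : Type := F.sig.VK × F.eid.Cmd
/-- A challenge with policy `c_p = (id, rs, Policy)`. -/
abbrev Scheme.PolChal (_F : Scheme n lam Srv Attr) : Type := (Srv × List Bool) × Finset Attr

/-- `IssCred`. -/
def Scheme.issCred (att : Finset Attr) : RO n (Ask F) := do
  let (dg, pk, sk) ← Prog.sample (F.eid.issue att)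
  let h ← Prog.query dg
  let p ← Prog.sample (F.eid.paSign h pk)
  return ⟨dg, h, pk, sk, p⟩

/-- Attestation request: the eID is read and a nonce is chosen. -/
def Scheme.reqAttest (a : Ask F) (c : Srv × List Bool) : RO n (Nonce lam × Req F) := do
  let r ← Prog.sample (PMF.uniformOfFintype (Nonce lam))
  return (r, ⟨a.digest, a.pk, a.paSig, c, r⟩)

/-- The mediator's challenge. -/
def Scheme.attestChal (req : Req F) (sk : F.sig.SK) (vk : F.sig.VK) :
    RO n (F.MedSt × F.MedChal) := do
  let key ← Prog.sample (F.eid.ke req.pk sk)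
  let cmd ← Prog.sample (F.eid.aeEnc key)
  return ((req, key), (vk, cmd))

/-- The response to the mediator's challenge, by chip authentication. -/
def Scheme.attestResp (ch : F.MedChal) (a : Ask F) : RO n F.eid.CAResp :=
  Prog.sample (F.eid.ca ch.1 ch.2 a.sk)

/-- The mediator's attestation `att_m = H(H(DG) ‖ nonce) ‖ c`, signed if the passive and chip
authentication are accepted. -/
def Scheme.attest (st : F.MedSt) (resp : F.eid.CAResp) (sk : F.sig.SK) :
    RO n (AttMsg n Srv × Option F.sig.Sig) := do
  let h ← Prog.query (salted st.1.digest st.1.nonce)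
  let att : AttMsg n Srv := (h, st.1.c)
  if F.eid.paVerify st.1.digest st.1.pk st.1.paSig && F.eid.caVerify resp st.2 then do
    let s ← Prog.sample (F.sig.sign sk att)
    return (att, some s)
  else return (att, none)

/-- The client's proof of attribute possession, computed with the given prover. If the data groups
do not satisfy the policy, there is no witness and the proof is `⊥`. -/
def Scheme.proveAC {J : Type} {Q : J → Type}
    (prover : Stmt n Attr → Wit lam → Prog J Q (Option F.zk.Pf))
    (att : AttMsg n Srv) (s : Option F.sig.Sig) (r : Nonce lam) (dg : List Bool)
    (pol : Finset Attr) : Prog J Q F.Proof := do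
  let p ← if pol ⊆ F.eid.attrs dg then prover (att.1, pol) (dg, r) else pure none
  return (att, s, p)

/-- The server's check of a proof of attribute possession. -/
def Scheme.checkAC (crs : F.zk.Crs) (a : F.Proof) (pol : Finset Attr) (vk : F.sig.VK)
    (c : Srv × List Bool) : RO n Bool := do
  let bM := match a.2.1 with
    | some s => F.sig.verify vk a.1 s
    | none => false
  let bZ ← match a.2.2 with
    | some p => F.zk.verify crs (a.1.1, pol) p
    | none => pure false
  return bM && bZ && decide (a.1.2 = c)

/-- The challenge with policy that a server sends; it is also the server's state. -/
def Scheme.challengeAC (pol : Srv → Finset Attr) (j : ℕ) (S : Srv) :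
    RO n (F.PolChal × F.PolChal) := do
  let rs ← Prog.sample (F.pla.challenge j S)
  return (((S, rs), pol S), ((S, rs), pol S))

/-- The server's check at registration. -/
def Scheme.rcheckAC (crs : F.zk.Crs) (vk : F.sig.VK) (st : F.PolChal) (cid : F.pla.Cid)
    (r : F.pla.Resp × F.Proof) : RO n (Bool × F.pla.Cred) := do
  let d ← Prog.query (F.encode r.2)
  let a ← Prog.sample (F.pla.rcheck (st.1.1, st.1.2 ++ List.ofFn d) cid r.1)
  let b ← F.checkAC crs r.2 st.2 vk st.1
  return (a.1 && b, a.2)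

/-- The server's check at authentication. -/
def Scheme.acheckAC (crs : F.zk.Crs) (vk : F.sig.VK) (st : F.PolChal)
    (rcs : F.pla.Cid → Option F.pla.Cred) (cid : F.pla.Cid) (r : F.pla.Resp × F.Proof) :
    RO n Bool := do
  let d ← Prog.query (F.encode r.2)
  let a ← Prog.sample (F.pla.acheck (st.1.1, st.1.2 ++ List.ofFn d) rcs cid r.1)
  let b ← F.checkAC crs r.2 st.2 vk st.1
  return a && b

/-- The interaction of the client with the mediator: nonce and attestation. -/
def Scheme.attested (vk : F.sig.VK) (sk : F.sig.SK) (a : Ask F) (c : Srv × List Bool) :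
    RO n (Nonce lam × AttMsg n Srv × Option F.sig.Sig) := do
  let (r, req) ← F.reqAttest a c
  let (st, ch) ← F.attestChal req sk vk
  let resp ← F.attestResp ch a
  let (att, s) ← F.attest st resp sk
  return (r, att, s)

/-- The client part of FIDO-AC on a challenge with policy: attestation by the mediator, proof of
attribute possession, and the message for the token, computed from the challenge extended by the
hash of `Π_Att`. -/
def Scheme.client {J : Type} {Q : J → Type} (hash : List Bool → Prog J Q (Digest n))
    (prover : Stmt n Attr → Wit lam → Prog J Q (Option F.zk.Pf))
    (vk : F.sig.VK) (sk : F.sig.SK) (a : Ask F) (j : ℕ) (id : Srv) (cp : F.PolChal) :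
    Prog J Q (F.pla.Msg × F.Proof) := do
  let (r, att, s) ← (F.attested vk sk a cp.1).via hash
  let p ← F.proveAC prover att s r a.dg cp.2
  let d ← hash (F.encode p)
  let M ← Prog.sample (F.pla.command j id (cp.1.1, cp.1.2 ++ List.ofFn d))
  return (M, p)

/-! ### The unlinkability experiment for FIDO-AC -/

/-- The input of the token oracles: a message for the token, or a challenge with policy for which
the oracle shall also run the client part. -/
abbrev Scheme.TokenIn : Type := F.pla.Msg ⊕ F.PolChal

/-- The oracles of the unlinkability experiment for FIDO-AC. -/
inductive ACQuery (m : ℕ) : Type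
  | hash (x : List Bool)
  | start (S : Srv) (i j : ℕ)
  | challenge (T : Fin m) (i j : ℕ) (id : Srv) (cid : F.pla.Cid) (M : F.TokenIn)
  | complete (S : Srv) (i j : ℕ) (cid : F.pla.Cid) (r : F.pla.Resp × F.Proof)
  | medReq (T : Fin m) (c : Srv × List Bool)
  | medChal (i : ℕ) (req : Req F)
  | medResp (T : Fin m) (ch : F.MedChal)
  | medAttest (i : ℕ) (resp : F.eid.CAResp)
  | lr (side : Bool) (cid : F.pla.Cid) (M : F.TokenIn)

/-- The answer of a token oracle: the token's response and, if the client part was run, `Π_Att`. -/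
abbrev Scheme.TokenOut : Type := Option (F.pla.TokenResp × Option F.Proof)

variable {F} {m : ℕ}

abbrev ACQuery.Ans : ACQuery F m → Type
  | .hash _ => Digest n
  | .start _ _ _ => Option F.PolChal
  | .challenge _ _ _ _ _ _ => F.TokenOut
  | .complete _ _ _ _ _ => Option Bool
  | .medReq _ _ => Nonce lam × Req F
  | .medChal _ _ => F.MedChal
  | .medResp _ _ => F.eid.CAResp
  | .medAttest _ _ => Option (AttMsg n Srv × Option F.sig.Sig)
  | .lr _ _ _ => F.TokenOut

variable (F m)

/-- The policies of the servers and the attributes of the tokens. -/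
structure Setup where
  pol : Srv → Finset Attr
  att : Fin m → Finset Attr

variable {F m}

/-- Both tokens satisfy the policy of each of the two servers, or none does. -/
def Setup.Compliant (o : Setup (Srv := Srv) (Attr := Attr) m) (tgt : Target m Srv) : Prop :=
  ∀ side, o.pol (tgt.S side) ⊆ o.att (tgt.T false) ↔ o.pol (tgt.S side) ⊆ o.att (tgt.T true)

variable (F m)

/-- An adversary against the unlinkability of FIDO-AC with `m` tokens. It first calls `Setup`; Phase
1 ends with the choice of Phase 2; Phase 3 ends with the output of a bit. -/
structure ACAdversary where
  State0 : Type
  State : Type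
  setup : F.zk.Crs → F.sig.VK → RO n (Setup (Srv := Srv) (Attr := Attr) m × State0)
  phase1 : (o : Setup (Srv := Srv) (Attr := Attr) m) → State0 →
    Prog (ACQuery F m) ACQuery.Ans ({tgt : Target m Srv // o.Compliant tgt} × State)
  phase3 : State → Prog (ACQuery F m) ACQuery.Ans Bool

/-- Everything but the token keys: public parameters, mediator keys, policies, credentials of the
tokens, server tables, mediator sessions, the choice of Phase 2, the number of answered queries to
`Left` and to `Right`, and the number of all queries to these two oracles. -/
structure Env where
  crs : F.zk.Crs
  vk : F.sig.VK
  sk : F.sig.SK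
  pol : Srv → Finset Attr
  ask : Fin m → Ask F
  srv : ServerState Srv F.PolChal F.pla.Cid F.pla.Cred
  med : ℕ → Option F.MedSt
  target : Option (Target m Srv)
  answered : Bool → ℕ
  queries : ℕ

variable {F m}

/-- The oracles of the experiment, over oracles `hash` and `token` for the hash function and for
running tokens. In the `k`-th query to `Left` and `Right`, counted from `0`, the client part uses the
credential of `T_{which k side}` and the prover `prover k`. -/
def acOracle {J : Type} {Q : J → Type} (hash : List Bool → Prog J Q (Digest n))
    (token : TokenQuery F.pla m → Prog J Q (Option F.pla.TokenResp))
    (prover : ℕ → F.zk.Crs → Stmt n Attr → Wit lam → Prog J Q (Option F.zk.Pf))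
    (which : ℕ → Bool → Bool) :
    (q : ACQuery F m) → Env F m → Prog J Q (q.Ans × Env F m)
  | .hash x, e => do
      let y ← hash x
      return (y, e)
  | .start S i j, e => do
      let r ← (e.srv.startOracle (F.challengeAC e.pol j S) S i j).via hash
      return (r.1, { e with srv := r.2 })
  | .challenge T i j id cid (.inl M), e => do
      let a ← token (.challenge T i j id cid M)
      return (a.map (fun a => (a, none)), e)
  | .challenge T i j id cid (.inr cp), e => do
      let (M, p) ← F.client hash (fun s w => (F.zk.prove e.crs s w).via hash) e.vk e.sk (e.ask T) j
        id cp
      let a ← token (.challenge T i j id cid M)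
      return (a.map (fun a => (a, some p)), e)
  | .complete S i j cid r, e => do
      let r ← (e.srv.completeOracle (F.rcheckAC e.crs e.vk) (F.acheckAC e.crs e.vk) S i j cid r).via
        hash
      return (r.1, { e with srv := r.2 })
  | .medReq T c, e => do
      let r ← (F.reqAttest (e.ask T) c).via hash
      return (r, e)
  | .medChal i req, e => do
      let r ← (F.attestChal req e.sk e.vk).via hash
      return (r.2, { e with med := Function.update e.med i (some r.1) })
  | .medResp T ch, e => do
      let r ← (F.attestResp ch (e.ask T)).via hash
      return (r, e)
  | .medAttest i resp, e => do
      match e.med i with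
      | none => return (none, e)
      | some st =>
        let r ← (F.attest st resp e.sk).via hash
        return (some r, e)
  | .lr side cid M, e => do
      let e' : Env F m := { e with queries := e.queries + 1 }
      match e.target with
      | none => return (none, e')
      | some tgt =>
        let pol := e.pol (tgt.S side)
        let e'' : Env F m :=
          { e' with answered := Function.update e.answered side (e.answered side + 1) }
        match M with
        | .inl M =>
          if F.polExt M = pol then do
            let a ← token (.lr side cid M)
            return (a.map (fun a => (a, none)), e'')
          else return (none, e')
        | .inr cp =>
          if cp.2 = pol then do
            let (M, p) ← F.client hash (prover e.queries e.crs) e.vk e.sk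
              (e.ask (tgt.T (which e.queries side))) (e.answered side) (tgt.S side) cp
            let a ← token (.lr side cid M)
            return (a.map (fun a => (a, some p)), e'')
          else return (none, e')

/-- The setup phase, for a given common reference string. -/
def ACAdversary.runSetup (A : ACAdversary F m) (crs : F.zk.Crs) :
    RO n ((Setup (Srv := Srv) (Attr := Attr) m × A.State0) × Env F m) := do
  let (vk, sk) ← Prog.sample F.sig.keyGen
  let (o, st) ← A.setup crs vk
  let ask ← Prog.replicate m (fun T => F.issCred (o.att T))
  return ((o, st), ⟨crs, vk, sk, o.pol, ask, ServerState.empty, fun _ => none, none,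
    fun _ => 0, 0⟩)

/-- Queries to the hash function and to the token oracles. -/
inductive CoreQuery (F : Scheme n lam Srv Attr) (m : ℕ) : Type
  | hash (x : List Bool)
  | token (q : TokenQuery F.pla m)

abbrev CoreQuery.Ans : CoreQuery F m → Type
  | .hash _ => Digest n
  | .token _ => Option F.pla.TokenResp

/-- `acOracle` with the honest prover. -/
def acHonest (which : ℕ → Bool → Bool) (q : ACQuery F m) (e : Env F m) :
    Prog (CoreQuery F m) CoreQuery.Ans (q.Ans × Env F m) :=
  acOracle (fun x => Prog.query (CoreQuery.hash x)) (fun q => Prog.query (CoreQuery.token q))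
    (fun _ crs s w => (F.zk.prove crs s w).via (fun x => Prog.query (CoreQuery.hash x))) which q e

/-- The token oracles, run on the token keys. -/
def coreOracle : (q : CoreQuery F m) → TokenState F.pla m → RO n (q.Ans × TokenState F.pla m)
  | .hash x, s => do
      let y ← Prog.query x
      return (y, s)
  | .token q, s => Prog.sample (s.answer q)

/-- The unlinkability experiment for FIDO-AC. With secret bit `b`, `Left` runs the token `T_b` with
its credential, and `Right` the token `T_{1-b}` with its credential. -/
def acUnl (x : Level) (A : ACAdversary F m) : RO n Bool := do
  let crs ← F.zk.setup
  let msk ← Prog.replicate m (fun _ => Prog.sample F.pla.gen)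
  let ((o, st₀), e₀) ← A.runSetup crs
  let (((tgt, st), e₁), s₁) ← ((A.phase1 o st₀).sim (acHonest (fun _ side => side)) e₀).sim
    coreOracle (TokenState.start msk)
  let b ← Prog.sample (PMF.uniformOfFintype Bool)
  let ((g, _), s) ← ((A.phase3 st).sim (acHonest (fun _ side => xor b side))
    { e₁ with target := some tgt.1 }).sim coreOracle { s₁ with phase2 := some (tgt.1, b) }
  return wins x tgt.1 s₁ s b g

/-- The unlinkability advantage against FIDO-AC in the random oracle model. -/
def acUnlAdvantage (x : Level) (A : ACAdversary F m) : ℝ :=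
  |(acUnl x A).exec.prTrue - 1 / 2|

/-! ### Numbers of queries -/

/-- In every execution, the queries of `A` cost at most `q`, where a direct query to the hash
function costs `h` in the setup phase and the costs in the later phases are given by `c`. -/
def ACAdversary.Within (A : ACAdversary F m) (h : ℕ) (c : ACQuery F m → ℕ) (q : ℕ) : Prop :=
  ∀ crs vk, (A.setup crs vk).Spends (fun _ => h) q fun r q =>
    (A.phase1 r.1 r.2).Spends c q fun r q => (A.phase3 r.2).AtMost c q

/-- The number of queries to `Left` (`side = false`) or `Right` (`side = true`) is at most `q`. -/
def ACAdversary.SideQueries (A : ACAdversary F m) (side : Bool) (q : ℕ) : Prop :=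
  A.Within 0 (fun
    | .lr s _ _ => if s = side then 1 else 0
    | _ => 0) q

/-- The number of hash queries caused by a query of the adversary. -/
def ACQuery.hashCost : ACQuery F m → ℕ
  | .hash _ => 1
  | .challenge _ _ _ _ _ (.inr _) => 2 + F.zk.qProve
  | .lr _ _ (.inr _) => 2 + F.zk.qProve
  | .complete _ _ _ _ _ => 1 + F.zk.qVer
  | .medAttest _ _ => 1
  | _ => 0

/-- The number of all random oracle queries in the experiment is at most `q`: the setup of the proof
system, one query for the data groups of each of the `m` tokens, and the queries that the adversary
makes itself or causes the oracles to make. -/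
def ACAdversary.HashQueries (A : ACAdversary F m) (q : ℕ) : Prop :=
  ∃ q', A.Within 1 ACQuery.hashCost q' ∧ F.zk.qSetup + m + q' ≤ q

/-! ### The adversaries against the building blocks that are obtained from `A` -/

/-- Answering hash queries by lazy sampling, and forwarding token queries. -/
def forward : (q : CoreQuery F m) → Table n →
    Prog (PLAQuery F.pla m) PLAQuery.Ans (q.Ans × Table n)
  | .hash x, t => lazyHash x t
  | .token q, t => do
      let a ← Prog.query (PLAQuery.token q)
      return (a, t)

/-- `A` as an adversary against the underlying `PLA`: it runs `A` once, and simulates the random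
oracle, the servers, the mediator, the eIDs and the client by running their algorithms. Every query
to `Challenge`, `Left` or `Right` causes at most one query to the oracle of the same name of the
`PLA` experiment. Not knowing the secret bit, it uses the credentials of `T₀` in `Left` and of `T₁`
in `Right`. -/
def ACAdversary.toPLA (A : ACAdversary F m) : PLAAdversary F.pla m where
  State := A.State × Env F m × Table n
  phase1 := do
    let (((o, st₀), e₀), t₀) ← Prog.sim lazyHash
      (do let crs ← F.zk.setup
          A.runSetup crs : RO n _) (fun _ => none)
    let (((tgt, st), e₁), t₁) ← ((A.phase1 o st₀).sim (acHonest (fun _ side => side)) e₀).sim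
      forward t₀
    return (tgt.1, st, { e₁ with target := some tgt.1 }, t₁)
  phase3 := fun (st, e, t) => do
    let ((g, _), _) ← ((A.phase3 st).sim (acHonest (fun _ side => side)) e).sim forward t
    return g

/-- Queries to the hash function, to the token oracles, and for one proof. -/
inductive HybridQuery (F : Scheme n lam Srv Attr) (m : ℕ) : Type
  | core (q : CoreQuery F m)
  | submit (s : Stmt n Attr) (w : Wit lam)

abbrev HybridQuery.Ans : HybridQuery F m → Type
  | .core q => q.Ans
  | .submit _ _ => Option F.zk.Pf

/-- `acOracle` where the proof in the `k`-th query to `Left` and `Right` is requested from outside,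
and all other proofs are computed by the honest prover. -/
def acHybrid (k : ℕ) (which : ℕ → Bool → Bool) (q : ACQuery F m) (e : Env F m) :
    Prog (HybridQuery F m) HybridQuery.Ans (q.Ans × Env F m) :=
  acOracle (fun x => Prog.query (HybridQuery.core (.hash x)))
    (fun q => Prog.query (HybridQuery.core (.token q)))
    (fun k' crs s w => if k' = k then Prog.query (HybridQuery.submit s w)
      else (F.zk.prove crs s w).via (fun x => Prog.query (HybridQuery.core (.hash x)))) which q e

/-- Running the token oracles on the token keys, inside a zero-knowledge adversary. -/
def hybridOracle : (q : HybridQuery F m) → TokenState F.pla m →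
    Prog (ZKQuery n lam Attr) (ZKQuery.Ans F.zk.Pf) (q.Ans × TokenState F.pla m)
  | .core (.hash x), s => do
      let y ← Prog.query (ZKQuery.hash x)
      return (y, s)
  | .core (.token q), s => Prog.sample (s.answer q)
  | .submit s w, t => do
      let p ← Prog.query (ZKQuery.submit s w)
      return (p, t)

/-- `A` as an adversary against the zero-knowledge property, when it makes at most `q` queries to
`Left` and `Right`: it runs the experiment once with secret bit `1` by running the algorithms of all
parties, except that it submits statement and witness of one of these queries, chosen at random, to
its challenger. The earlier ones use the right credential, the later ones the credential of the other
token, and a random bit decides for the chosen query. If nothing was submitted, a true statement on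
the empty policy is submitted at the end. -/
def ACAdversary.toZK (A : ACAdversary F m) (x : Level) (q : ℕ) : ZKAdversary F.zk := fun crs =>
  if hq : 0 < q then do
    have : Nonempty (Fin q) := ⟨⟨0, hq⟩⟩
    let k ← Prog.sample (PMF.uniformOfFintype (Fin q))
    let d ← Prog.sample (PMF.uniformOfFintype Bool)
    let which : ℕ → Bool → Bool := fun k' side =>
      if k' < k.1 ∨ (k' = k.1 ∧ d = true) then !side else side
    let msk ← Prog.replicate m (fun _ => Prog.sample F.pla.gen)
    let ((o, st₀), e₀) ← (A.runSetup crs).via (fun x => Prog.query (ZKQuery.hash x))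
    let (((tgt, st), e₁), s₁) ← ((A.phase1 o st₀).sim (acHybrid k.1 which) e₀).sim
      hybridOracle (TokenState.start msk)
    let ((g, _), s) ← ((A.phase3 st).sim (acHybrid k.1 which)
      { e₁ with target := some tgt.1 }).sim hybridOracle { s₁ with phase2 := some (tgt.1, true) }
    let a := e₁.ask (tgt.1.T false)
    let r : Nonce lam := fun _ => false
    let y ← Prog.query (ZKQuery.hash (salted a.digest r))
    let _ ← Prog.query (ZKQuery.submit (y, ∅) (a.dg, r))
    return xor (wins x tgt.1 s₁ s true g) d
  else return false

end Protocol

end FidoAC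

end

/-! Let W(w, b) be the probability that the experiment returns 1 with secret bit b when the
credentials in `Left` and `Right` are selected by w, while the token keys are always selected by b
(`winProb`). The FIDO-AC experiment averages W over b with the credentials following b. The
reduction to `PLA` does not know b and never swaps credentials. Its experiment therefore has the
same term for b = 0, and for b = 1 the tokens are swapped but the credentials are not. Both
identities are exact (`acUnl_prTrue`, `plaUnl_prTrue`), so it remains to bound half the difference,
at b = 1, between swapping the credentials in all queries to `Left` and `Right` and swapping them in
none.

This difference is treated by hybrids: `swapped j` swaps the credentials in the first j of the q =
qL + qR queries. The zero-knowledge adversary draws a position k and a bit d, plays the hybrid k + d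
with the k-th proof obtained from its challenger, and outputs the result xored with d. With real
proofs the sum over k telescopes, and its success probability is 1/2 plus 1/(2q) times the
difference of the extreme hybrids (`zkReal_eq`). The factor 1/2 from d matches the factor 1/2 from
b, so the two experiments differ by exactly q times the bias of this adversary.

With simulated proofs the bias is at most qH / 2^lam (`zkSim_le`). A simulated proof depends on the
statement only. Attestation with an issued credential always succeeds, and compliance makes both
tokens satisfy the policy or neither. Hence the k-th query depends on the credential only through
the salted hash H(H(DG) ‖ nonce) (`wp_lr_simulated`). The nonce is used nowhere else, so it may be
drawn after the run. Unless it hits one of the at most qH determined points of the hash function,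
the salted hash is indistinguishable from a random digest (`wp_random_le_salted`,
`wp_salted_le_random`). Passing from one credential through a random digest to the other costs two
such errors (`wp_game_swap_le`), and the factor 1/2 of the guess d reduces this to one.

For the real challenger one also needs that all submitted statements are true, and that checking
them does not disturb the hash table. Both hold because H(DG) and the salted hash are already
determined at that moment (`wp_zkGame`). -/

open scoped ENNReal

noncomputable section

namespace FidoAC

/-! ### Algebra of probabilistic programs and of layered oracles -/

namespace Prog

variable {I J K : Type} {O : I → Type} {P : J → Type} {Q : K → Type} {α β γ τ υ : Type}

@[simp] theorem bind_eq (p : Prog I O α) (f : α → Prog I O β) : p >>= f = p.bind f := rfl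
@[simp] theorem pure_eq (a : α) : (pure a : Prog I O α) = ret a := rfl
@[simp] theorem ret_bind (a : α) (f : α → Prog I O β) : (ret a).bind f = f a := rfl
@[simp] theorem ask_bind (i : I) (k : O i → Prog I O α) (f : α → Prog I O β) :
    (ask i k).bind f = ask i fun o => (k o).bind f := rfl
@[simp] theorem draw_bind (p : PMF γ) (k : γ → Prog I O α) (f : α → Prog I O β) :
    (draw p k).bind f = draw p fun x => (k x).bind f := rfl
@[simp] theorem sim_ret (h : (i : I) → τ → Prog J P (O i × τ)) (a : α) (s : τ) :
    (ret a : Prog I O α).sim h s = ret (a, s) := rfl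
@[simp] theorem sim_ask (h : (i : I) → τ → Prog J P (O i × τ)) (i : I) (k : O i → Prog I O α)
    (s : τ) : (ask i k).sim h s = (h i s).bind fun r => (k r.1).sim h r.2 := rfl
@[simp] theorem sim_draw (h : (i : I) → τ → Prog J P (O i × τ)) (p : PMF γ)
    (k : γ → Prog I O α) (s : τ) :
    (draw p k).sim h s = draw p fun x => (k x).sim h s := rfl
@[simp] theorem via_ret (h : (i : I) → Prog J P (O i)) (a : α) :
    (ret a : Prog I O α).via h = ret a := rfl
@[simp] theorem via_ask (h : (i : I) → Prog J P (O i)) (i : I) (k : O i → Prog I O α) :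
    (ask i k).via h = (h i).bind fun r => (k r).via h := rfl
@[simp] theorem via_draw (h : (i : I) → Prog J P (O i)) (p : PMF γ) (k : γ → Prog I O α) :
    (draw p k).via h = draw p fun x => (k x).via h := rfl

@[simp] theorem bind_ret (p : Prog I O α) : p.bind ret = p := by
  induction p with
  | ret a => rfl
  | ask i k ih => simp [ih]
  | draw p k ih => simp [ih]

@[simp] theorem bind_assoc (p : Prog I O α) (f : α → Prog I O β) (g : β → Prog I O γ) :
    (p.bind f).bind g = p.bind fun a => (f a).bind g := by
  induction p with
  | ret a => rfl
  | ask i k ih => simp [ih]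
  | draw p k ih => simp [ih]

@[simp] theorem sim_bind (h : (i : I) → τ → Prog J P (O i × τ)) (p : Prog I O α)
    (f : α → Prog I O β) (s : τ) :
    (p.bind f).sim h s = (p.sim h s).bind fun r => (f r.1).sim h r.2 := by
  induction p generalizing s with
  | ret a => rfl
  | ask i k ih => simp [ih]
  | draw p k ih => simp [ih]

@[simp] theorem via_bind (h : (i : I) → Prog J P (O i)) (p : Prog I O α)
    (f : α → Prog I O β) : (p.bind f).via h = (p.via h).bind fun r => (f r).via h := by
  induction p with
  | ret a => rfl
  | ask i k ih => simp [ih]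
  | draw p k ih => simp [ih]

@[simp] theorem via_via (h : (i : I) → Prog J P (O i)) (g : (j : J) → Prog K Q (P j))
    (p : Prog I O α) : (p.via h).via g = p.via fun i => (h i).via g := by
  induction p with
  | ret a => rfl
  | ask i k ih => simp [ih]
  | draw p k ih => simp [ih]

@[simp] theorem via_query (p : Prog I O α) : p.via (fun i => query i) = p := by
  induction p with
  | ret a => rfl
  | ask i k ih => exact congrArg (ask i) (funext ih)
  | draw p k ih => simp [ih]

@[simp] theorem query_bind (i : I) (f : O i → Prog I O α) : (query i).bind f = ask i f := rfl
@[simp] theorem query_sim (h : (i : I) → τ → Prog J P (O i × τ)) (i : I) (s : τ) :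
    (query i : Prog I O (O i)).sim h s = h i s := by simp [query]
@[simp] theorem query_via (h : (i : I) → Prog J P (O i)) (i : I) :
    (query i : Prog I O (O i)).via h = h i := by simp [query]
@[simp] theorem sample_bind (p : PMF γ) (f : γ → Prog I O α) :
    (sample p).bind f = draw p f := rfl
@[simp] theorem sample_sim (h : (i : I) → τ → Prog J P (O i × τ)) (p : PMF γ) (s : τ) :
    (sample p : Prog I O γ).sim h s = draw p fun x => ret (x, s) := rfl
@[simp] theorem sample_via (h : (i : I) → Prog J P (O i)) (p : PMF γ) :
    (sample p : Prog I O γ).via h = sample p := rfl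

theorem ite_bind (c : Prop) [Decidable c] (p q : Prog I O α) (f : α → Prog I O β) :
    (if c then p else q).bind f = if c then p.bind f else q.bind f := by
  split <;> rfl

theorem ite_via (c : Prop) [Decidable c] (h : (i : I) → Prog J P (O i)) (p q : Prog I O α) :
    (if c then p else q).via h = if c then p.via h else q.via h := by
  split <;> rfl

/-- A stateless implementation leaves the state of the next layer to that layer. -/
theorem via_sim (h : (i : I) → Prog J P (O i)) (g : (j : J) → τ → Prog K Q (P j × τ))
    (p : Prog I O α) (s : τ) :
    (p.via h).sim g s = p.sim (fun i s => (h i).sim g s) s := by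
  induction p generalizing s with
  | ret a => rfl
  | ask i k ih => simp [ih]
  | draw p k ih => simp [ih]

/-- If the implementation leaves the state alone, it is stateless. -/
theorem sim_stateless (h : (i : I) → Prog J P (O i)) (p : Prog I O α) (s : τ) :
    p.sim (fun i s => (h i).bind fun a => ret (a, s)) s = (p.via h).bind fun a => ret (a, s) := by
  induction p with
  | ret a => rfl
  | ask i k ih => simp [ih]
  | draw p k ih => simp [ih]

theorem replicate_sample_sim (h : (i : I) → τ → Prog J P (O i × τ)) (p : PMF α) (m : ℕ) (s : τ) :
    (replicate m (fun _ => (sample p : Prog I O α))).sim h s =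
      (replicate m (fun _ => sample p)).bind fun f => ret (f, s) := by
  induction m with
  | zero => rfl
  | succ m ih => simp [replicate, ih]

/-! ### Properties of all results -/

/-- Every result of `p`, whatever the oracles answer, satisfies `post`. -/
def All (post : α → Prop) : Prog I O α → Prop
  | ret a => post a
  | ask _ k => ∀ o, (k o).All post
  | draw _ k => ∀ x, (k x).All post

theorem All.bind {p : Prog I O α} {f : α → Prog I O β} {mid : α → Prop} {post : β → Prop}
    (hp : p.All mid) (hf : ∀ a, mid a → (f a).All post) : (p.bind f).All post := by
  induction p with
  | ret a => exact hf a hp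
  | ask i k ih => exact fun o => ih o (hp o)
  | draw p k ih => exact fun o => ih o (hp o)

theorem All.mono {p : Prog I O α} {P' Q' : α → Prop} (hp : p.All P') (h : ∀ a, P' a → Q' a) :
    p.All Q' := by
  induction p with
  | ret a => exact h a hp
  | ask i k ih => exact fun o => ih o (hp o)
  | draw p k ih => exact fun o => ih o (hp o)

theorem all_of_forall {p : Prog I O α} {post : α → Prop} (h : ∀ a, post a) : p.All post := by
  induction p with
  | ret a => exact h a
  | ask i k ih => exact fun o => ih o
  | draw p k ih => exact fun o => ih o

theorem all_bind_of_forall {p : Prog I O α} {f : α → Prog I O β} {post : β → Prop}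
    (hf : ∀ a, (f a).All post) : (p.bind f).All post :=
  All.bind (mid := fun _ => True) (all_of_forall fun _ => trivial) fun a _ => hf a

/-- `All` ranges over all draws, even those of probability zero. This makes the conclusion an
equality of programs and not only of distributions. -/
theorem bind_congr_all {p : Prog I O α} {f g : α → Prog I O β} {post : α → Prop}
    (hp : p.All post) (h : ∀ a, post a → f a = g a) : p.bind f = p.bind g := by
  induction p with
  | ret a => exact h a hp
  | ask i k ih => simp only [ask_bind]; congr; funext o; exact ih o (hp o)
  | draw p k ih => simp only [draw_bind]; congr; funext o; exact ih o (hp o)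

theorem All.sim_result {p : Prog I O α} {post : α → Prop} (hp : p.All post)
    (h : (i : I) → τ → Prog J P (O i × τ)) (s : τ) : (p.sim h s).All fun r => post r.1 := by
  induction p generalizing s with
  | ret a => exact hp
  | ask i k ih => exact all_bind_of_forall fun r => ih r.1 (hp r.1) r.2
  | draw p k ih => exact fun x => ih x (hp x) s

theorem all_sim_state {p : Prog I O α} {h : (i : I) → τ → Prog J P (O i × τ)} {inv : τ → Prop}
    (hh : ∀ i s, inv s → (h i s).All fun r => inv r.2) {s : τ} (hs : inv s) :
    (p.sim h s).All fun r => inv r.2 := by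
  induction p generalizing s with
  | ret a => exact hs
  | ask i k ih => exact All.bind (hh i s hs) fun r hr => ih r.1 hr
  | draw p k ih => exact fun x => ih x hs

/-! ### Numbers of queries -/

theorem Spends.mono {c : I → ℕ} {p : Prog I O α} {n : ℕ} {P' Q' : α → ℕ → Prop}
    (hp : p.Spends c n P') (h : ∀ a n, P' a n → Q' a n) : p.Spends c n Q' := by
  induction p generalizing n with
  | ret a => exact h _ _ hp
  | ask i k ih => exact ⟨hp.1, fun o => ih o (hp.2 o)⟩
  | draw p k ih => exact fun x hx => ih x (hp x hx)

theorem Spends.bind {c : I → ℕ} {p : Prog I O α} {f : α → Prog I O β} {n : ℕ}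
    {mid : α → ℕ → Prop} {post : β → ℕ → Prop} (hp : p.Spends c n mid)
    (hf : ∀ a n, mid a n → (f a).Spends c n post) : (p.bind f).Spends c n post := by
  induction p generalizing n with
  | ret a => exact hf _ _ hp
  | ask i k ih => exact ⟨hp.1, fun o => ih o (hp.2 o)⟩
  | draw p k ih => exact fun x hx => ih x (hp x hx)

theorem Spends.frame {c : I → ℕ} {p : Prog I O α} {n : ℕ} {post : α → ℕ → Prop}
    (hp : p.Spends c n post) (r : ℕ) :
    p.Spends c (n + r) fun a n' => ∃ n'', n' = n'' + r ∧ post a n'' := by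
  induction p generalizing n with
  | ret a => exact ⟨_, rfl, hp⟩
  | ask i k ih =>
    have h1 : c i ≤ n := hp.1
    refine ⟨by omega, fun o => ?_⟩
    have := ih o (hp.2 o)
    rwa [show n - c i + r = n + r - c i by omega] at this
  | draw p k ih => exact fun x hx => ih x (hp x hx)

/-- Spending at most `n` out of `n'` leaves at least `n' - n`. -/
theorem AtMost.spends {c : I → ℕ} {p : Prog I O α} {n n' : ℕ} (hp : p.AtMost c n) (h : n ≤ n') :
    p.Spends c n' fun _ r => n' - n ≤ r := by
  have := Spends.frame hp (n' - n)
  rw [show n + (n' - n) = n' by omega] at this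
  exact this.mono fun a r => by rintro ⟨s, rfl, -⟩; omega

theorem AtMost.bind {c : I → ℕ} {p : Prog I O α} {f : α → Prog I O β} {n n' : ℕ}
    (hp : p.AtMost c n) (hf : ∀ a, (f a).AtMost c n') : (p.bind f).AtMost c (n + n') := by
  refine Spends.bind (hp.spends (Nat.le_add_right n n')) fun a r hr => ?_
  exact Spends.mono ((hf a).spends (show n' ≤ r by omega)) fun _ _ _ => trivial

theorem AtMost.mono {c : I → ℕ} {p : Prog I O α} {n n' : ℕ} (hp : p.AtMost c n) (h : n ≤ n') :
    p.AtMost c n' := (hp.spends h).mono fun _ _ _ => trivial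

theorem atMost_ret {c : I → ℕ} (a : α) (n : ℕ) : (ret a : Prog I O α).AtMost c n := trivial
theorem atMost_sample {c : I → ℕ} (p : PMF α) (n : ℕ) : (sample p : Prog I O α).AtMost c n :=
  fun _ _ => trivial
theorem atMost_query {c : I → ℕ} (i : I) : (query i : Prog I O (O i)).AtMost c (c i) :=
  ⟨le_rfl, fun _ => trivial⟩
theorem atMost_ite {c : I → ℕ} {b : Prop} [Decidable b] {p q : Prog I O α} {n : ℕ}
    (hp : p.AtMost c n) (hq : q.AtMost c n) : (if b then p else q).AtMost c n := by
  split <;> assumption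

/-- Budgets for two cost functions are tracked side by side. This turns separate bounds for `Left`
and `Right` into one bound for both. -/
theorem Spends.add {c₁ c₂ : I → ℕ} {p : Prog I O α} {n₁ n₂ : ℕ} {P₁ P₂ : α → ℕ → Prop}
    (h₁ : p.Spends c₁ n₁ P₁) (h₂ : p.Spends c₂ n₂ P₂) :
    p.Spends (fun i => c₁ i + c₂ i) (n₁ + n₂)
      fun a n => ∃ m₁ m₂, n = m₁ + m₂ ∧ P₁ a m₁ ∧ P₂ a m₂ := by
  induction p generalizing n₁ n₂ with
  | ret a => exact ⟨_, _, rfl, h₁, h₂⟩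
  | ask i k ih =>
    have e₁ : c₁ i ≤ n₁ := h₁.1
    have e₂ : c₂ i ≤ n₂ := h₂.1
    refine ⟨show c₁ i + c₂ i ≤ n₁ + n₂ by omega, fun o => ?_⟩
    have := ih o (h₁.2 o) (h₂.2 o)
    rwa [show n₁ - c₁ i + (n₂ - c₂ i) = n₁ + n₂ - (c₁ i + c₂ i) by omega] at this
  | draw p k ih => exact fun x hx => ih x (h₁ x hx) (h₂ x hx)

/-- Each implementation may use less than the price of the query it answers, so the real remainder
can exceed the accounted one; hence the slack `k' ≤ k`. -/
theorem Spends.sim {c : I → ℕ} {c' : J → ℕ} {p : Prog I O α} {n n' : ℕ} {post : α → ℕ → Prop}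
    {h : (i : I) → τ → Prog J P (O i × τ)} (hp : p.Spends c n post)
    (hh : ∀ i s, (h i s).AtMost c' (c i)) (hn : n ≤ n') (s : τ) :
    (p.sim h s).Spends c' n' fun r k => ∃ k' ≤ k, post r.1 k' := by
  induction p generalizing n n' s with
  | ret a => exact ⟨n, hn, hp⟩
  | ask i k ih =>
    have e : c i ≤ n := hp.1
    refine Spends.bind ((hh i s).spends (e.trans hn)) fun r l hl => ?_
    exact ih r.1 (hp.2 r.1) (by omega) r.2
  | draw p k ih => exact fun x hx => ih x (hp x hx) hn s

theorem AtMost.via {c : I → ℕ} {c' : J → ℕ} {p : Prog I O α} {n : ℕ}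
    {h : (i : I) → Prog J P (O i)} (hp : p.AtMost c n) (hh : ∀ i, (h i).AtMost c' (c i)) :
    (p.via h).AtMost c' n := by
  induction p generalizing n with
  | ret a => trivial
  | ask i k ih =>
    have := AtMost.bind (hh i) fun r => ih r (hp.2 r)
    rwa [Nat.add_sub_cancel' hp.1] at this
  | draw p k ih => exact fun x hx => ih x (hp x hx)

theorem Spends.replicate {c : I → ℕ} {m n : ℕ} {p : Fin m → Prog I O α} {a : ℕ}
    (h : ∀ i, (p i).AtMost c a) : (replicate m p).Spends c (n + m * a) fun _ r => n ≤ r := by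
  induction m generalizing n with
  | zero => exact show n ≤ n + 0 * a by omega
  | succ m ih =>
    refine Spends.bind ((h 0).spends (by nlinarith)) fun x r hr => ?_
    have e : n + (m + 1) * a - a = n + m * a := by rw [Nat.succ_mul]; omega
    -- The reserve `n` is enlarged to whatever the first sample left over beyond the price of the
    -- other `m` samples.
    have H := ih (n := r - m * a) fun i => h i.succ
    rw [show r - m * a + m * a = r by omega] at H
    exact Spends.bind H fun f r' hr' => show n ≤ r' by omega

end Prog

/-! ### Expected values -/

/-- Expected value of `f` of the result. -/
def Rand.ev {α : Type} : Rand α → (α → ℝ≥0∞) → ℝ≥0∞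
  | .ret a, f => f a
  | .ask i _, _ => i.elim
  | .draw p k, f => ∑' x, p x * Rand.ev (k x) f

theorem Rand.toPMF_apply {α : Type} [DecidableEq α] (p : Rand α) (a : α) :
    p.toPMF a = p.ev fun b => if b = a then 1 else 0 := by
  induction p with
  | ret b => simp [Rand.toPMF, Rand.ev, PMF.pure_apply, eq_comm]
  | ask i => exact i.elim
  | draw p k ih => simp [Rand.toPMF, Rand.ev, PMF.bind_apply, ih]

@[simp] theorem Rand.ev_ret {α : Type} (a : α) (f : α → ℝ≥0∞) :
    Rand.ev (.ret a) f = f a := rfl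
@[simp] theorem Rand.ev_draw {α β : Type} (p : PMF β) (k : β → Rand α) (f : α → ℝ≥0∞) :
    Rand.ev (.draw p k) f = ∑' x, p x * (k x).ev f := rfl

@[simp] theorem Rand.ev_bind {α β : Type} (p : Rand α) (g : α → Rand β) (f : β → ℝ≥0∞) :
    Rand.ev (p.bind g) f = p.ev fun a => (g a).ev f := by
  induction p with
  | ret b => rfl
  | ask i => exact i.elim
  | draw p k ih => simp [ih]

/-- The event that a Boolean is true, as a random variable. -/
def bit (b : Bool) : ℝ≥0∞ := if b = true then 1 else 0

@[simp] theorem bit_true : bit true = 1 := rfl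
@[simp] theorem bit_false : bit false = 0 := rfl
theorem bit_le_one (b : Bool) : bit b ≤ 1 := by cases b <;> simp
theorem bit_add_not (b : Bool) : bit b + bit (!b) = 1 := by cases b <;> simp

theorem Rand.prTrue_eq (p : Rand Bool) : p.prTrue = (p.ev bit).toReal := by
  rw [Rand.prTrue, Rand.toPMF_apply]; rfl

theorem pmf_sum_const {β : Type} (p : PMF β) (c : ℝ≥0∞) : ∑' x, p x * c = c := by
  rw [ENNReal.tsum_mul_right, p.tsum_coe, one_mul]

/-! ### Expected values under lazy sampling of the hash function -/

namespace RO

variable {n : ℕ} {α β γ : Type}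

/-- Expected value of `f` of the result and the final table, when the hash function is sampled
lazily from a table. -/
def wp (p : RO n α) (f : α → Table n → ℝ≥0∞) (t : Table n) : ℝ≥0∞ :=
  Rand.ev (p.sim lazyHash t) fun r => f r.1 r.2

@[simp] theorem wp_ret (a : α) (f : α → Table n → ℝ≥0∞) (t : Table n) :
    wp (.ret a) f t = f a t := rfl

theorem wp_ask_some {x : List Bool} {t : Table n} {y : Digest n} (h : t x = some y)
    (k : Digest n → RO n α) (f : α → Table n → ℝ≥0∞) :
    wp (.ask x k) f t = wp (k y) f t := by
  simp [wp, lazyHash, h]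

theorem wp_ask_none {x : List Bool} {t : Table n} (h : t x = none)
    (k : Digest n → RO n α) (f : α → Table n → ℝ≥0∞) :
    wp (.ask x k) f t = ∑' y, PMF.uniformOfFintype (Digest n) y *
      wp (k y) f (Function.update t x (some y)) := by
  simp [wp, lazyHash, h]

@[simp] theorem wp_draw (p : PMF β) (k : β → RO n α) (f : α → Table n → ℝ≥0∞) (t : Table n) :
    wp (.draw p k) f t = ∑' x, p x * wp (k x) f t := rfl

@[simp] theorem wp_bind (p : RO n α) (g : α → RO n β) (f : β → Table n → ℝ≥0∞) (t : Table n) :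
    wp (p.bind g) f t = wp p (fun a t => wp (g a) f t) t := by
  simp [wp]

theorem prTrue_exec (p : RO n Bool) :
    p.exec.prTrue = (wp p (fun a _ => bit a) fun _ => none).toReal := by
  rw [Rand.prTrue_eq, RO.exec]; simp [wp]

theorem wp_congr_all {p : RO n α} {post : α → Prop} (hp : p.All post)
    {f g : α → Table n → ℝ≥0∞} {t : Table n} (h : ∀ a t', post a → f a t' = g a t') :
    wp p f t = wp p g t := by
  induction p generalizing t with
  | ret a => exact h a t hp
  | ask x k ih =>
    cases ht : t x with
    | none => simp only [wp_ask_none ht]; congr; funext y; rw [ih y (hp y)]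
    | some y => simp only [wp_ask_some ht]; exact ih y (hp y)
  | draw p k ih => simp only [wp_draw]; congr; funext y; rw [ih y (hp y)]

theorem wp_const (p : RO n α) (c : ℝ≥0∞) (t : Table n) : wp p (fun _ _ => c) t = c := by
  induction p generalizing t with
  | ret a => rfl
  | ask x k ih =>
    cases ht : t x with
    | none => simp only [wp_ask_none ht, ih, pmf_sum_const]
    | some y => simp only [wp_ask_some ht, ih]
  | draw p k ih => simp only [wp_draw, ih, pmf_sum_const]

/-- Expected values are linear even for infinite weighted sums, by Tonelli in `ℝ≥0∞`. This is what
allows a later draw to be moved in front of a run, or an earlier one behind it. -/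
theorem wp_sum {ι : Type} (p : RO n α) (w : ι → ℝ≥0∞) (f : ι → α → Table n → ℝ≥0∞)
    (t : Table n) :
    wp p (fun a t => ∑' i, w i * f i a t) t = ∑' i, w i * wp p (f i) t := by
  induction p generalizing t with
  | ret a => rfl
  | ask x k ih =>
    cases ht : t x with
    | none =>
      simp only [wp_ask_none ht, ih, ← ENNReal.tsum_mul_left]
      rw [ENNReal.tsum_comm]
      simp only [mul_left_comm]
    | some y => simp only [wp_ask_some ht, ih]
  | draw p k ih =>
    simp only [wp_draw, ih, ← ENNReal.tsum_mul_left]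
    rw [ENNReal.tsum_comm]
    simp only [mul_left_comm]

theorem wp_add (p : RO n α) (f g : α → Table n → ℝ≥0∞) (t : Table n) :
    wp p (fun a t => f a t + g a t) t = wp p f t + wp p g t := by
  have := wp_sum p (fun _ : Bool => 1) (fun b => if b then f else g) t
  simpa [tsum_bool, add_comm] using this

/-! ### Properties of the reachable results -/

/-- Every result and final table that can be reached from table `t` satisfies `post`. -/
def Ends : RO n α → Table n → (α → Table n → Prop) → Prop
  | .ret a, t, post => post a t
  | .ask x k, t, post => (∀ y, t x = some y → Ends (k y) t post) ∧
      (t x = none → ∀ y, Ends (k y) (Function.update t x (some y)) post)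
  | .draw p k, t, post => ∀ x ∈ p.support, Ends (k x) t post

theorem Ends.bind {p : RO n α} {f : α → RO n β} {t : Table n} {mid : α → Table n → Prop}
    {post : β → Table n → Prop} (hp : Ends p t mid) (hf : ∀ a t, mid a t → Ends (f a) t post) :
    Ends (p.bind f) t post := by
  induction p generalizing t with
  | ret a => exact hf _ _ hp
  | ask i k ih => exact ⟨fun y hy => ih y (hp.1 y hy), fun h y => ih y (hp.2 h y)⟩
  | draw p k ih => exact fun x hx => ih x (hp x hx)

theorem Ends.mono {p : RO n α} {t : Table n} {P Q : α → Table n → Prop}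
    (hp : Ends p t P) (h : ∀ a t, P a t → Q a t) : Ends p t Q := by
  induction p generalizing t with
  | ret a => exact h _ _ hp
  | ask i k ih => exact ⟨fun y hy => ih y (hp.1 y hy), fun h y => ih y (hp.2 h y)⟩
  | draw p k ih => exact fun x hx => ih x (hp x hx)

theorem Ends.and {p : RO n α} {t : Table n} {P Q : α → Table n → Prop}
    (hp : Ends p t P) (hq : Ends p t Q) : Ends p t fun a t => P a t ∧ Q a t := by
  induction p generalizing t with
  | ret a => exact ⟨hp, hq⟩
  | ask i k ih =>
    exact ⟨fun y hy => ih y (hp.1 y hy) (hq.1 y hy), fun h y => ih y (hp.2 h y) (hq.2 h y)⟩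
  | draw p k ih => exact fun x hx => ih x (hp x hx) (hq x hx)

theorem Ends.of_all {p : RO n α} {post : α → Prop} (hp : p.All post) (t : Table n) :
    Ends p t fun a _ => post a := by
  induction p generalizing t with
  | ret a => exact hp
  | ask i k ih => exact ⟨fun y _ => ih y (hp y) _, fun _ y => ih y (hp y) _⟩
  | draw p k ih => exact fun x _ => ih x (hp x) _

/-- An additive error of the continuation passes through unchanged, since the weights of every draw
sum to one. Draws outside the support have weight zero, so a postcondition on reachable results
suffices. -/
theorem wp_le {p : RO n α} {t : Table n} {post : α → Table n → Prop} (hp : Ends p t post)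
    {f g : α → Table n → ℝ≥0∞} {c : ℝ≥0∞} (h : ∀ a t', post a t' → f a t' ≤ g a t' + c) :
    wp p f t ≤ wp p g t + c := by
  induction p generalizing t with
  | ret a => exact h _ _ hp
  | ask x k ih =>
    cases ht : t x with
    | none =>
      simp only [wp_ask_none ht]
      rw [← pmf_sum_const (PMF.uniformOfFintype (Digest n)) c, ← ENNReal.tsum_add]
      refine ENNReal.tsum_le_tsum fun y => ?_
      rw [← mul_add]
      exact mul_le_mul_right (ih y (hp.2 ht y)) _
    | some y =>
      simp only [wp_ask_some ht]
      exact ih y (hp.1 y ht)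
  | draw p k ih =>
    simp only [wp_draw]
    rw [← pmf_sum_const p c, ← ENNReal.tsum_add]
    refine ENNReal.tsum_le_tsum fun y => ?_
    rw [← mul_add]
    by_cases hy : y ∈ p.support
    · exact mul_le_mul_right (ih y (hp y hy)) _
    · rw [PMF.mem_support_iff, not_not] at hy
      simp [hy]

theorem wp_congr {p : RO n α} {t : Table n} {post : α → Table n → Prop} (hp : Ends p t post)
    {f g : α → Table n → ℝ≥0∞} (h : ∀ a t', post a t' → f a t' = g a t') :
    wp p f t = wp p g t := by
  apply le_antisymm
  · simpa using wp_le hp (c := 0) (f := f) (g := g) fun a t' hh => by rw [h a t' hh, add_zero]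
  · simpa using wp_le hp (c := 0) (f := g) (g := f) fun a t' hh => by rw [h a t' hh, add_zero]

theorem wp_mono {p : RO n α} {t : Table n} {f g : α → Table n → ℝ≥0∞}
    (h : ∀ a t', f a t' ≤ g a t') : wp p f t ≤ wp p g t := by
  simpa using wp_le (c := 0) (Ends.of_all (post := fun _ => True)
    (Prog.all_of_forall fun _ => trivial) t) (f := f) (g := g) fun a t' _ => by simpa using h a t'

theorem wp_le_one {p : RO n α} {t : Table n} {f : α → Table n → ℝ≥0∞}
    (h : ∀ a t', f a t' ≤ 1) : wp p f t ≤ 1 :=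
  (wp_mono (g := fun _ _ => 1) h).trans (wp_const p 1 t).le

/-- Every determined value of `t` is also determined in `t'`. -/
def _root_.FidoAC.Table.Le (t t' : Table n) : Prop := ∀ x y, t x = some y → t' x = some y

theorem table_le_refl (t : Table n) : t.Le t := fun _ _ h => h
theorem table_le_trans {t u v : Table n} (h : t.Le u) (h' : u.Le v) : t.Le v :=
  fun x y e => h' x y (h x y e)
theorem table_le_update {t : Table n} {x : List Bool} (h : t x = none) (y : Digest n) :
    t.Le (Function.update t x (some y)) := by
  intro z w e
  by_cases hz : z = x
  · subst hz; simp [h] at e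
  · simpa [Function.update_of_ne hz] using e

theorem ends_le (p : RO n α) (t : Table n) : Ends p t fun _ t' => t.Le t' := by
  induction p generalizing t with
  | ret a => exact table_le_refl t
  | ask x k ih =>
    exact ⟨fun y _ => ih y t, fun h y => (ih y _).mono fun _ _ =>
      table_le_trans (table_le_update h y)⟩
  | draw p k ih => exact fun x _ => ih x t

/-- At most `N` values of `t` are determined. -/
def _root_.FidoAC.Table.Size (t : Table n) (N : ℕ) : Prop :=
  ∃ s : Finset (List Bool), s.card ≤ N ∧ ∀ x ∉ s, t x = none

/-- The size of the table plus the remaining budget never grows: a query costs one unit and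
determines at most one new value. -/
theorem Ends.of_spends {p : RO n α} {k : ℕ} {post : α → ℕ → Prop}
    (hp : p.Spends (fun _ => 1) k post) {t : Table n} {M N : ℕ} (ht : t.Size M) (hN : M + k ≤ N) :
    Ends p t fun a t' => ∃ k' M', post a k' ∧ t'.Size M' ∧ M' + k' ≤ N := by
  induction p generalizing t k M with
  | ret a => exact ⟨k, M, hp, ht, hN⟩
  | ask x c ih =>
    have h1 : 1 ≤ k := hp.1
    refine ⟨fun y _ => ih y (hp.2 y) ht (show M + (k - 1) ≤ N by omega), fun _ y => ih y (hp.2 y) (M := M + 1) ?_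
      (show M + 1 + (k - 1) ≤ N by omega)⟩
    obtain ⟨s, hs, hs'⟩ := ht
    classical
    refine ⟨insert x s, (Finset.card_insert_le x s).trans (by omega), fun z hz => ?_⟩
    rw [Finset.mem_insert, not_or] at hz
    rw [Function.update_of_ne hz.1]
    exact hs' z hz.2
  | draw p c ih => exact fun x hx => ih x (hp x hx) ht hN

/-! ### Reprogramming the hash function -/

/-- Lazy sampling never forgets a determined value, so the event is impossible. -/
theorem wp_eq_zero_of_determined (p : RO n α) {t : Table n} {x : List Bool} (h : t x ≠ none)
    (f : α → ℝ≥0∞) : wp p (fun a t' => if t' x = none then f a else 0) t = 0 := by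
  obtain ⟨y, hy⟩ := Option.ne_none_iff_exists'.1 h
  refine (wp_congr (ends_le p t) fun a t' ht' => ?_).trans (wp_const p 0 t)
  simp [ht' x y hy]

/-- On runs that never query `x`, the value programmed at `x` is invisible, so those runs occur with
the same weight from the programmed table. Runs that query `x` contribute nothing on the left. -/
theorem wp_program_le (p : RO n α) (t : Table n) (x : List Bool) (y : Digest n) (f : α → ℝ≥0∞) :
    wp p (fun a t' => if t' x = none then f a else 0) t ≤
      wp p (fun a _ => f a) (Function.update t x (some y)) := by
  induction p generalizing t with
  | ret a => simp only [wp_ret]; split <;> simp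
  | ask z k ih =>
    by_cases hx : t x = none
    swap
    · rw [wp_eq_zero_of_determined _ hx]; exact zero_le
    by_cases hz : z = x
    · subst hz
      rw [wp_ask_none hx]
      refine le_trans (le_of_eq ?_) zero_le
      refine ENNReal.tsum_eq_zero.2 fun w => ?_
      rw [wp_eq_zero_of_determined _ (by simp), mul_zero]
    · have hu : Function.update t x (some y) z = t z := Function.update_of_ne hz _ _
      cases ht : t z with
      | some w =>
        rw [wp_ask_some ht, wp_ask_some (hu.trans ht)]
        exact ih w t
      | none =>
        rw [wp_ask_none ht, wp_ask_none (hu.trans ht)]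
        refine ENNReal.tsum_le_tsum fun w => mul_le_mul_right ?_ _
        rw [Function.update_comm (Ne.symm hz)]
        exact ih w _
  | draw p k ih =>
    simp only [wp_draw]
    exact ENNReal.tsum_le_tsum fun w => mul_le_mul_right (ih w t) _

end RO

open Prog

open scoped Classical

variable {n lam : ℕ} {Srv Attr : Type} {F : Scheme n lam Srv Attr} {m : ℕ}

/-! ### The oracles of the FIDO-AC experiment -/

/-- The data of the environment that no query changes. -/
structure Env.Frame (e e' : Env F m) : Prop where
  crs : e'.crs = e.crs
  vk : e'.vk = e.vk
  sk : e'.sk = e.sk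
  pol : e'.pol = e.pol
  ask : e'.ask = e.ask
  target : e'.target = e.target

theorem Env.Frame.refl (e : Env F m) : e.Frame e := ⟨rfl, rfl, rfl, rfl, rfl, rfl⟩

theorem Env.Frame.trans {e e' e'' : Env F m} (h : e.Frame e') (h' : e'.Frame e'') :
    e.Frame e'' :=
  ⟨h'.crs.trans h.crs, h'.vk.trans h.vk, h'.sk.trans h.sk, h'.pol.trans h.pol,
    h'.ask.trans h.ask, h'.target.trans h.target⟩

/-- The number of queries to `Left` and `Right`. -/
def ACQuery.lrCost : ACQuery F m → ℕ
  | .lr _ _ _ => 1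
  | _ => 0

/-- The query runs the client part in `Left` or `Right`. -/
def ACQuery.RunsClient (e : Env F m) (q : ACQuery F m) : Prop :=
  ∃ side cid cp tgt, q = .lr side cid (.inr cp) ∧ e.target = some tgt ∧ cp.2 = e.pol (tgt.S side)

section

variable {J K : Type} {Q : J → Type} {R : K → Type}

/-- The counter advances at every query to `Left` and `Right`, also a refused one. A hybrid index
therefore designates at most one query of a run. -/
theorem acOracle_all (hash : List Bool → Prog J Q (Digest n))
    (token : TokenQuery F.pla m → Prog J Q (Option F.pla.TokenResp))
    (prover : ℕ → F.zk.Crs → Stmt n Attr → Wit lam → Prog J Q (Option F.zk.Pf))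
    (which : ℕ → Bool → Bool) (q : ACQuery F m) (e : Env F m) :
    (acOracle hash token prover which q e).All
      fun r => e.Frame r.2 ∧ r.2.queries = e.queries + q.lrCost := by
  have key : ∀ (α : Type) (p : Prog J Q α) (f : α → Prog J Q (q.Ans × Env F m)),
      (∀ a, (f a).All fun r => e.Frame r.2 ∧ r.2.queries = e.queries + q.lrCost) →
      (p.bind f).All fun r => e.Frame r.2 ∧ r.2.queries = e.queries + q.lrCost :=
    fun α p f h => all_bind_of_forall h
  rcases q with x | ⟨S, i, j⟩ | ⟨T, i, j, id, cid, M | cp⟩ | ⟨S, i, j, cid, r⟩ | ⟨T, c⟩ |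
    ⟨i, req⟩ | ⟨T, ch⟩ | ⟨i, resp⟩ | ⟨side, cid, M | cp⟩
  all_goals simp only [acOracle, bind_eq, pure_eq]
  case challenge.inr =>
    exact key _ _ _ fun a => key _ _ _ fun b => ⟨⟨rfl, rfl, rfl, rfl, rfl, rfl⟩, rfl⟩
  case medAttest =>
    split
    · exact ⟨⟨rfl, rfl, rfl, rfl, rfl, rfl⟩, rfl⟩
    · exact key _ _ _ fun a => ⟨⟨rfl, rfl, rfl, rfl, rfl, rfl⟩, rfl⟩
  case lr.inl =>
    split
    · exact ⟨⟨rfl, rfl, rfl, rfl, rfl, rfl⟩, rfl⟩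
    · split
      · exact key _ _ _ fun a => ⟨⟨rfl, rfl, rfl, rfl, rfl, rfl⟩, rfl⟩
      · exact ⟨⟨rfl, rfl, rfl, rfl, rfl, rfl⟩, rfl⟩
  case lr.inr =>
    split
    · exact ⟨⟨rfl, rfl, rfl, rfl, rfl, rfl⟩, rfl⟩
    · split
      · exact key _ _ _ fun a => key _ _ _ fun b => ⟨⟨rfl, rfl, rfl, rfl, rfl, rfl⟩, rfl⟩
      · exact ⟨⟨rfl, rfl, rfl, rfl, rfl, rfl⟩, rfl⟩
  all_goals exact key _ _ _ fun a => ⟨⟨rfl, rfl, rfl, rfl, rfl, rfl⟩, rfl⟩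

/-- The prover and the selection of credentials are consulted only when `Left` or `Right` runs the
client part, and then only at the current value of the counter. -/
theorem acOracle_congr (hash : List Bool → Prog J Q (Digest n))
    (token : TokenQuery F.pla m → Prog J Q (Option F.pla.TokenResp))
    {prover prover' : ℕ → F.zk.Crs → Stmt n Attr → Wit lam → Prog J Q (Option F.zk.Pf)}
    {which which' : ℕ → Bool → Bool} {q : ACQuery F m} {e : Env F m}
    (h : q.RunsClient e →
      prover e.queries = prover' e.queries ∧ which e.queries = which' e.queries) :
    acOracle hash token prover which q e = acOracle hash token prover' which' q e := by
  rcases q with x | ⟨S, i, j⟩ | ⟨T, i, j, id, cid, M | cp⟩ | ⟨S, i, j, cid, r⟩ | ⟨T, c⟩ |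
    ⟨i, req⟩ | ⟨T, ch⟩ | ⟨i, resp⟩ | ⟨side, cid, M | cp⟩
  case lr.inr =>
    simp only [acOracle]
    cases ht : e.target with
    | none => rfl
    | some tgt =>
      by_cases hp : cp.2 = e.pol (tgt.S side)
      · obtain ⟨h₁, h₂⟩ := h ⟨side, cid, cp, tgt, rfl, ht, hp⟩
        simp only [h₁, h₂]
      · simp only [hp, if_false]
  all_goals rfl

theorem proveAC_via (h : (j : J) → Prog K R (Q j))
    (prover : Stmt n Attr → Wit lam → Prog J Q (Option F.zk.Pf)) (att : AttMsg n Srv)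
    (s : Option F.sig.Sig) (r : Nonce lam) (dg : List Bool) (pol : Finset Attr) :
    (F.proveAC prover att s r dg pol).via h =
      F.proveAC (fun s w => (prover s w).via h) att s r dg pol := by
  simp only [Scheme.proveAC, bind_eq, pure_eq, via_bind, ite_via, via_ret]

theorem client_via (h : (j : J) → Prog K R (Q j)) (hash : List Bool → Prog J Q (Digest n))
    (prover : Stmt n Attr → Wit lam → Prog J Q (Option F.zk.Pf)) (vk : F.sig.VK) (sk : F.sig.SK)
    (a : Ask F) (j : ℕ) (id : Srv) (cp : F.PolChal) :
    (F.client hash prover vk sk a j id cp).via h =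
      F.client (fun x => (hash x).via h) (fun s w => (prover s w).via h) vk sk a j id cp := by
  simp only [Scheme.client, bind_eq, pure_eq, via_bind, via_via, proveAC_via, sample_via, via_ret]

theorem acOracle_via (h : (j : J) → Prog K R (Q j)) (hash : List Bool → Prog J Q (Digest n))
    (token : TokenQuery F.pla m → Prog J Q (Option F.pla.TokenResp))
    (prover : ℕ → F.zk.Crs → Stmt n Attr → Wit lam → Prog J Q (Option F.zk.Pf))
    (which : ℕ → Bool → Bool) (q : ACQuery F m) (e : Env F m) :
    (acOracle hash token prover which q e).via h =
      acOracle (fun x => (hash x).via h) (fun q => (token q).via h)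
        (fun k c s w => (prover k c s w).via h) which q e := by
  rcases q with x | ⟨S, i, j⟩ | ⟨T, i, j, id, cid, M | cp⟩ | ⟨S, i, j, cid, r⟩ | ⟨T, c⟩ |
    ⟨i, req⟩ | ⟨T, ch⟩ | ⟨i, resp⟩ | ⟨side, cid, M | cp⟩
  all_goals simp only [acOracle, bind_eq, pure_eq, via_bind, via_via, client_via, via_ret]
  case medAttest => split <;> simp
  case lr.inl => split <;> simp [ite_via]
  case lr.inr => split <;> simp [ite_via, client_via]

end

/-- The oracles where the proof in the `k`-th query to `Left` and `Right` is computed by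
`prover k`. -/
def acWith (prover : ℕ → F.zk.Crs → Stmt n Attr → Wit lam → RO n (Option F.zk.Pf))
    (which : ℕ → Bool → Bool) (q : ACQuery F m) (e : Env F m) :
    Prog (CoreQuery F m) CoreQuery.Ans (q.Ans × Env F m) :=
  acOracle (fun x => Prog.query (CoreQuery.hash x)) (fun q => Prog.query (CoreQuery.token q))
    (fun k crs s w => (prover k crs s w).via fun x => Prog.query (CoreQuery.hash x)) which q e

theorem acHonest_eq (which : ℕ → Bool → Bool) :
    acHonest (F := F) (m := m) which = acWith (fun _ => F.zk.prove) which := rfl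

/-- What `Left` and `Right` do after the proof of attribute possession was computed. -/
def lrTail (side : Bool) (cid : F.pla.Cid) (cp : F.PolChal) (tgt : Target m Srv) (e : Env F m)
    (p : F.Proof) : Prog (CoreQuery F m) CoreQuery.Ans (F.TokenOut × Env F m) :=
  (Prog.query (CoreQuery.hash (F.encode p))).bind fun d =>
    (Prog.sample (F.pla.command (e.answered side) (tgt.S side)
      (cp.1.1, cp.1.2 ++ List.ofFn d))).bind fun M =>
    (Prog.query (CoreQuery.token (.lr side cid M))).bind fun a =>
    .ret (a.map (fun a => (a, some p)), { e with
      queries := e.queries + 1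
      answered := Function.update e.answered side (e.answered side + 1) })

theorem acWith_lr {prover : ℕ → F.zk.Crs → Stmt n Attr → Wit lam → RO n (Option F.zk.Pf)}
    {which : ℕ → Bool → Bool} {side : Bool} {cid : F.pla.Cid} {cp : F.PolChal} {e : Env F m}
    {tgt : Target m Srv} (ht : e.target = some tgt) (hp : cp.2 = e.pol (tgt.S side)) :
    acWith prover which (.lr side cid (.inr cp)) e =
      ((F.attested e.vk e.sk (e.ask (tgt.T (which e.queries side))) cp.1).via
        fun x => Prog.query (CoreQuery.hash x)).bind fun r =>
      ((F.proveAC (prover e.queries e.crs) r.2.1 r.2.2 r.1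
        (e.ask (tgt.T (which e.queries side))).dg cp.2).via
          fun x => Prog.query (CoreQuery.hash x)).bind fun p =>
      lrTail side cid cp tgt e p := by
  simp only [acWith, acOracle, ht, hp, if_true, Scheme.client, bind_eq, pure_eq, bind_assoc,
    proveAC_via, lrTail, ret_bind]

theorem acHybrid_lr {k : ℕ} {which : ℕ → Bool → Bool} {side : Bool} {cid : F.pla.Cid}
    {cp : F.PolChal} {e : Env F m} {tgt : Target m Srv} (ht : e.target = some tgt)
    (hp : cp.2 = e.pol (tgt.S side)) (hk : e.queries = k) :
    acHybrid k which (.lr side cid (.inr cp)) e =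
      ((F.attested e.vk e.sk (e.ask (tgt.T (which e.queries side))) cp.1).via
        fun x => Prog.query (HybridQuery.core (.hash x))).bind fun r =>
      (F.proveAC (fun s w => Prog.query (HybridQuery.submit s w)) r.2.1 r.2.2 r.1
        (e.ask (tgt.T (which e.queries side))).dg cp.2).bind fun p =>
      (lrTail side cid cp tgt e p).via fun c => Prog.query (HybridQuery.core c) := by
  simp only [acHybrid, acOracle, ht, hp, if_true, Scheme.client, bind_eq, pure_eq, bind_assoc,
    lrTail, ret_bind, hk, via_bind, query_via, sample_via, via_ret]

/-- Away from the `k`-th client run nothing is submitted, so the hybrid oracles are the core oracles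
relayed unchanged. `zkOracle_core` then removes the relay. -/
theorem acHybrid_eq_via {k : ℕ} {which : ℕ → Bool → Bool} {q : ACQuery F m} {e : Env F m}
    {prover : ℕ → F.zk.Crs → Stmt n Attr → Wit lam → RO n (Option F.zk.Pf)}
    (h : q.RunsClient e → e.queries ≠ k ∧ prover e.queries = F.zk.prove) :
    acHybrid k which q e = (acWith prover which q e).via
      fun c => Prog.query (HybridQuery.core c) := by
  rw [acWith, acOracle_via, acHybrid]
  simp only [query_via, via_via]
  refine acOracle_congr _ _ fun hc => ⟨?_, rfl⟩
  obtain ⟨h₁, h₂⟩ := h hc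
  simp only [h₁, h₂, if_false]

/-! ### Layers of oracles -/

theorem coreOracle_hash (p : RO n α) (s : TokenState F.pla m) :
    (p.via fun x => Prog.query (CoreQuery.hash x)).sim coreOracle s =
      p.bind fun a => .ret (a, s) := by
  rw [via_sim]
  simp only [query_sim]
  exact (sim_stateless (fun x => Prog.query x) p s).trans (by rw [via_query])

theorem zkOracle_hash {Pf : Type} (attrs : List Bool → Finset Attr)
    (prover : Stmt n Attr → Wit lam → RO n (Option Pf)) {α : Type} (p : RO n α)
    (v : Option Bool) :
    (p.via fun x => Prog.query (ZKQuery.hash x)).sim (zkOracle attrs prover) v =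
      p.bind fun a => .ret (a, v) := by
  rw [via_sim]
  simp only [query_sim]
  exact (sim_stateless (fun x => Prog.query x) p v).trans (by rw [via_query])

/-- Without a submission the challenger only relays hash queries, so its state `v` is carried along
and its prover never matters. -/
theorem zkOracle_core (prover : Stmt n Attr → Wit lam → RO n (Option F.zk.Pf)) {α : Type}
    (p : Prog (CoreQuery F m) CoreQuery.Ans α) (s : TokenState F.pla m) (v : Option Bool) :
    ((p.via fun c => Prog.query (HybridQuery.core c)).sim hybridOracle s).sim
      (zkOracle F.eid.attrs prover) v = (p.sim coreOracle s).bind fun r => .ret (r, v) := by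
  induction p generalizing s v with
  | ret a => rfl
  | ask i k ih =>
    cases i with
    | hash x =>
      simp only [via_ask, query_bind, sim_ask, hybridOracle, coreOracle, bind_eq, pure_eq,
        ret_bind, zkOracle, ask_bind, ih]
    | token q =>
      simp only [via_ask, query_bind, sim_ask, hybridOracle, coreOracle, draw_bind, sample_bind,
        ih, sim_draw]
  | draw p k ih => simp [ih]

/-- Lazy sampling asks no outer oracle, so a further layer of oracles around it is idle. -/
theorem lazyHash_sim {J K : Type} {Q : J → Type} {R : K → Type} {α τ : Type}
    (h : (j : J) → τ → Prog K R (Q j × τ)) (p : RO n α) (t : Table n) (s : τ) :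
    (p.sim (J := J) (P := Q) lazyHash t).sim h s = (p.sim lazyHash t).bind fun r => .ret (r, s) := by
  induction p generalizing t with
  | ret a => rfl
  | ask x k ih => cases ht : t x <;> simp [lazyHash, ht, ih]
  | draw p k ih => simp [ih]

/-- The reduction keeps the hash table inside the adversary, whereas the FIDO-AC experiment keeps it
outside the tokens; the two orders of the layers agree up to rearranging the states. The servers of
the `PLA` experiment stay untouched, because the reduction runs its own. -/
theorem forward_sim {α : Type} (p : Prog (CoreQuery F m) CoreQuery.Ans α) (t : Table n)
    (srv : F.pla.Servers) (s : TokenState F.pla m) :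
    (p.sim forward t).sim plaOracle (srv, s) = ((p.sim coreOracle s).sim lazyHash t).bind
      fun r => .ret ((r.1.1, r.2), srv, r.1.2) := by
  induction p generalizing t s with
  | ret a => rfl
  | ask i k ih =>
    cases i with
    | hash x => cases ht : t x <;> simp [forward, coreOracle, lazyHash, ht, ih]
    | token q => simp [forward, coreOracle, plaOracle, ih]
  | draw p k ih => simp [ih]

/-! ### Numbers of hash queries of the oracles -/

theorem Prog.AtMost.bind_le {I : Type} {O : I → Type} {α β : Type} {c : I → ℕ} {p : Prog I O α}
    {f : α → Prog I O β} {N : ℕ} (a b : ℕ) (hp : p.AtMost c a) (hf : ∀ x, (f x).AtMost c b)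
    (h : a + b ≤ N) : (p.bind f).AtMost c N :=
  AtMost.mono (AtMost.bind hp hf) h

/-- Hash queries cost `1`, token queries are free. -/
def CoreQuery.cost : CoreQuery F m → ℕ
  | .hash _ => 1
  | .token _ => 0

theorem atMost_attest (st : F.MedSt) (resp : F.eid.CAResp) (sk : F.sig.SK) :
    (F.attest st resp sk).AtMost (fun _ => 1) 1 := by
  refine AtMost.bind_le 1 0 (atMost_query _) (fun h => ?_) le_rfl
  dsimp only
  split
  · exact AtMost.bind_le 0 0 (atMost_sample _ _) (fun s => atMost_ret _ _) le_rfl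
  · exact atMost_ret _ _

theorem atMost_attested (vk : F.sig.VK) (sk : F.sig.SK) (a : Ask F) (c : Srv × List Bool) :
    (F.attested vk sk a c).AtMost (fun _ => 1) 1 := by
  refine AtMost.bind_le 0 1 ?_ (fun r => ?_) le_rfl
  · exact AtMost.bind_le 0 0 (atMost_sample _ _) (fun s => atMost_ret _ _) le_rfl
  refine AtMost.bind_le 0 1 ?_ (fun r' => ?_) le_rfl
  · exact AtMost.bind_le 0 0 (atMost_sample _ _)
      (fun s => AtMost.bind_le 0 0 (atMost_sample _ _) (fun s => atMost_ret _ _) le_rfl) le_rfl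
  refine AtMost.bind_le 0 1 (atMost_sample _ _) (fun s => ?_) le_rfl
  exact AtMost.bind_le 1 0 (atMost_attest _ _ _) (fun _ => atMost_ret _ _) le_rfl

theorem atMost_checkAC (crs : F.zk.Crs) (a : F.Proof) (pol : Finset Attr) (vk : F.sig.VK)
    (c : Srv × List Bool) : (F.checkAC crs a pol vk c).AtMost (fun _ => 1) F.zk.qVer := by
  unfold Scheme.checkAC
  dsimp only
  split
  · exact AtMost.bind_le F.zk.qVer 0 (F.zk.verify_le _ _ _) (fun d => atMost_ret _ _) le_rfl
  · exact atMost_ret _ _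

theorem atMost_proveAC {I : Type} {O : I → Type} {c : I → ℕ} {q : ℕ}
    {prover : Stmt n Attr → Wit lam → Prog I O (Option F.zk.Pf)}
    (hp : ∀ s w, (prover s w).AtMost c q) (att : AttMsg n Srv)
    (s : Option F.sig.Sig) (r : Nonce lam) (dg : List Bool) (pol : Finset Attr) :
    (F.proveAC prover att s r dg pol).AtMost c q := by
  unfold Scheme.proveAC
  split
  · exact AtMost.bind_le q 0 (hp _ _) (fun d => atMost_ret _ _) le_rfl
  · exact atMost_ret _ _

/-- A query to the hash function. -/
abbrev coreHash (F : Scheme n lam Srv Attr) (m : ℕ) (x : List Bool) :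
    Prog (CoreQuery F m) CoreQuery.Ans (Digest n) :=
  Prog.query (CoreQuery.hash x)

theorem atMost_via_hash {α : Type} {p : RO n α} {k : ℕ} (hp : p.AtMost (fun _ => 1) k) :
    (p.via (coreHash F m)).AtMost CoreQuery.cost k :=
  AtMost.via hp fun x => atMost_query (c := CoreQuery.cost) (CoreQuery.hash x)

theorem atMost_client {prover : Stmt n Attr → Wit lam → RO n (Option F.zk.Pf)}
    (hp : ∀ s w, (prover s w).AtMost (fun _ => 1) F.zk.qProve) (vk : F.sig.VK) (sk : F.sig.SK)
    (a : Ask F) (j : ℕ) (id : Srv) (cp : F.PolChal) :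
    (F.client (coreHash F m) (fun s w => (prover s w).via (coreHash F m)) vk sk a j id cp).AtMost
      CoreQuery.cost (2 + F.zk.qProve) := by
  refine AtMost.bind_le 1 (F.zk.qProve + 1) (atMost_via_hash (atMost_attested _ _ _ _))
    (fun r => ?_) (by omega)
  refine AtMost.bind_le F.zk.qProve 1 (atMost_proveAC (fun s w => atMost_via_hash (hp s w)) _ _ _
    _ _) (fun p => ?_) le_rfl
  refine AtMost.bind_le 1 0 (atMost_query (c := CoreQuery.cost) (CoreQuery.hash _)) (fun h => ?_)
    le_rfl
  exact AtMost.bind_le 0 0 (atMost_sample _ _) (fun s => atMost_ret _ _) le_rfl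

theorem atMost_complete (crs : F.zk.Crs) (vk : F.sig.VK) (S : Srv) (i j : ℕ) (cid : F.pla.Cid)
    (r : F.pla.Resp × F.Proof) (s : ServerState Srv F.PolChal F.pla.Cid F.pla.Cred) :
    (s.completeOracle (F.rcheckAC crs vk) (F.acheckAC crs vk) S i j cid r).AtMost (fun _ => 1)
      (1 + F.zk.qVer) := by
  unfold ServerState.completeOracle
  split
  · exact atMost_ret _ _
  refine atMost_ite (atMost_ret _ _) (atMost_ite ?_ (atMost_ite (atMost_ret _ _) ?_))
  · refine AtMost.bind_le (1 + F.zk.qVer) 0 ?_ (fun _ => atMost_ret _ _) le_rfl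
    refine AtMost.bind_le 1 F.zk.qVer (atMost_query _) (fun d => ?_) le_rfl
    refine AtMost.bind_le 0 F.zk.qVer (atMost_sample _ _) (fun d => ?_) (by omega)
    exact AtMost.bind_le F.zk.qVer 0 (atMost_checkAC _ _ _ _ _) (fun _ => atMost_ret _ _) le_rfl
  · refine AtMost.bind_le (1 + F.zk.qVer) 0 ?_ (fun _ => atMost_ret _ _) le_rfl
    refine AtMost.bind_le 1 F.zk.qVer (atMost_query _) (fun d => ?_) le_rfl
    refine AtMost.bind_le 0 F.zk.qVer (atMost_sample _ _) (fun d => ?_) (by omega)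
    exact AtMost.bind_le F.zk.qVer 0 (atMost_checkAC _ _ _ _ _) (fun _ => atMost_ret _ _) le_rfl

theorem atMost_token (q : TokenQuery F.pla m) :
    (Prog.query (CoreQuery.token q) : Prog (CoreQuery F m) CoreQuery.Ans _).AtMost
      CoreQuery.cost 0 :=
  atMost_query (c := CoreQuery.cost) (CoreQuery.token q)

theorem acWith_atMost {prover : ℕ → F.zk.Crs → Stmt n Attr → Wit lam → RO n (Option F.zk.Pf)}
    (hp : ∀ k crs s w, (prover k crs s w).AtMost (fun _ => 1) F.zk.qProve)
    (which : ℕ → Bool → Bool) (q : ACQuery F m) (e : Env F m) :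
    (acWith prover which q e).AtMost CoreQuery.cost q.hashCost := by
  have free : ∀ {α : Type} (a : α), (.ret a : Prog (CoreQuery F m) CoreQuery.Ans α).AtMost
      CoreQuery.cost 0 := fun a => atMost_ret a 0
  rcases q with x | ⟨S, i, j⟩ | ⟨T, i, j, id, cid, M | cp⟩ | ⟨S, i, j, cid, r⟩ | ⟨T, c⟩ |
    ⟨i, req⟩ | ⟨T, ch⟩ | ⟨i, resp⟩ | ⟨side, cid, M | cp⟩
  case hash =>
    exact AtMost.bind_le 1 0 (atMost_query (c := CoreQuery.cost) (CoreQuery.hash x))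
      (fun _ => free _) le_rfl
  case start =>
    refine AtMost.bind_le 0 0 (atMost_via_hash ?_) (fun _ => free _) le_rfl
    exact atMost_ite (atMost_ret _ _) (AtMost.bind_le 0 0
      (AtMost.bind_le 0 0 (atMost_sample _ _) (fun s => atMost_ret _ _) le_rfl)
      (fun s => atMost_ret _ _) le_rfl)
  case challenge.inl =>
    exact AtMost.bind_le 0 0 (atMost_token _) (fun _ => free _) le_rfl
  case challenge.inr =>
    refine AtMost.bind_le (2 + F.zk.qProve) 0 (atMost_client (fun s w => F.zk.prove_le _ _ _) _ _ _
      _ _ _) (fun _ => ?_) le_rfl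
    exact AtMost.bind_le 0 0 (atMost_token _) (fun _ => free _) le_rfl
  case complete =>
    exact AtMost.bind_le _ 0 (atMost_via_hash (atMost_complete _ _ _ _ _ _ _ _)) (fun _ => free _)
      le_rfl
  case medReq =>
    exact AtMost.bind_le 0 0 (atMost_via_hash (AtMost.bind_le 0 0 (atMost_sample _ _)
      (fun s => atMost_ret _ _) le_rfl)) (fun _ => free _) le_rfl
  case medChal =>
    exact AtMost.bind_le 0 0 (atMost_via_hash (AtMost.bind_le 0 0 (atMost_sample _ _)
      (fun s => AtMost.bind_le 0 0 (atMost_sample _ _) (fun s => atMost_ret _ _) le_rfl) le_rfl))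
      (fun _ => free _) le_rfl
  case medResp =>
    exact AtMost.bind_le 0 0 (atMost_via_hash (atMost_sample _ _)) (fun _ => free _) le_rfl
  case medAttest =>
    simp only [acWith, acOracle]
    split
    · exact atMost_ret _ _
    · exact AtMost.bind_le 1 0 (atMost_via_hash (atMost_attest _ _ _)) (fun _ => free _) le_rfl
  case lr.inl =>
    simp only [acWith, acOracle]
    split
    · exact atMost_ret _ _
    · exact atMost_ite (AtMost.bind_le 0 0 (atMost_token _) (fun _ => free _) le_rfl)
        (atMost_ret _ _)
  case lr.inr =>
    simp only [acWith, acOracle]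
    split
    · exact atMost_ret _ _
    · refine atMost_ite (AtMost.bind_le (2 + F.zk.qProve) 0 (atMost_client (fun s w => hp _ _ _ _)
        _ _ _ _ _ _) (fun _ => ?_) le_rfl) (atMost_ret _ _)
      exact AtMost.bind_le 0 0 (atMost_token _) (fun _ => free _) le_rfl

theorem coreOracle_atMost (q : CoreQuery F m) (s : TokenState F.pla m) :
    (coreOracle q s).AtMost (fun _ => 1) q.cost := by
  cases q with
  | hash x => exact AtMost.bind_le 1 0 (atMost_query _) (fun _ => atMost_ret _ _) le_rfl
  | token q => exact atMost_sample _ _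

theorem lrTail_atMost (side : Bool) (cid : F.pla.Cid) (cp : F.PolChal) (tgt : Target m Srv)
    (e : Env F m) (p : F.Proof) (s : TokenState F.pla m) :
    ((lrTail side cid cp tgt e p).sim coreOracle s).AtMost (fun _ => 1) 1 := by
  have : (lrTail side cid cp tgt e p).AtMost CoreQuery.cost 1 := by
    refine AtMost.bind_le 1 0 (atMost_query (c := CoreQuery.cost) (CoreQuery.hash _)) (fun h => ?_)
      le_rfl
    refine AtMost.bind_le 0 0 (atMost_sample _ _) (fun s => ?_) le_rfl
    exact AtMost.bind_le 0 0 (atMost_token _) (fun _ => atMost_ret _ _) le_rfl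
  exact (Spends.sim this coreOracle_atMost le_rfl s).mono fun _ _ _ => trivial

/-! ### Running an adversary against the token keys -/

/-- Run a phase of the adversary, with the tokens. -/
def game (prover : ℕ → F.zk.Crs → Stmt n Attr → Wit lam → RO n (Option F.zk.Pf))
    (which : ℕ → Bool → Bool) {α : Type} (p : Prog (ACQuery F m) ACQuery.Ans α) (e : Env F m)
    (s : TokenState F.pla m) : RO n ((α × Env F m) × TokenState F.pla m) :=
  (p.sim (acWith prover which) e).sim coreOracle s

section

variable {prover : ℕ → F.zk.Crs → Stmt n Attr → Wit lam → RO n (Option F.zk.Pf)}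
  {which : ℕ → Bool → Bool} {α : Type}

theorem game_ask (q : ACQuery F m) (k : q.Ans → Prog (ACQuery F m) ACQuery.Ans α) (e : Env F m)
    (s : TokenState F.pla m) :
    game prover which (.ask q k) e s = ((acWith prover which q e).sim coreOracle s).bind
      fun r => game prover which (k r.1.1) r.1.2 r.2 := by
  simp only [game, sim_ask, sim_bind]

theorem game_step_all (q : ACQuery F m) (e : Env F m) (s : TokenState F.pla m) :
    ((acWith prover which q e).sim coreOracle s).All
      fun r => e.Frame r.1.2 ∧ r.1.2.queries = e.queries + q.lrCost :=
  (acOracle_all _ _ _ _ q e).sim_result _ _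

theorem game_frame (p : Prog (ACQuery F m) ACQuery.Ans α) (e : Env F m)
    (s : TokenState F.pla m) :
    (game prover which p e s).All fun r => e.Frame r.1.2 := by
  refine All.sim_result (post := fun r : α × Env F m => e.Frame r.2) ?_ _ _
  exact all_sim_state (fun q e' he' => (acOracle_all _ _ _ _ q e').mono fun r hr =>
    he'.trans hr.1) (Env.Frame.refl e)

theorem game_spends (hp : ∀ k crs s w, (prover k crs s w).AtMost (fun _ => 1) F.zk.qProve)
    {p : Prog (ACQuery F m) ACQuery.Ans α} {c c' : ℕ} {post : α → ℕ → Prop}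
    (h : p.Spends ACQuery.hashCost c post) (hc : c ≤ c') (e : Env F m) (s : TokenState F.pla m) :
    (game prover which p e s).Spends (fun _ => 1) c' fun r k => ∃ k' ≤ k, post r.1.1 k' := by
  refine (Spends.sim (Spends.sim h (fun q e => acWith_atMost hp which q e) hc e)
    coreOracle_atMost le_rfl s).mono ?_
  rintro r k ⟨k', hk', k'', hk'', h⟩
  exact ⟨k'', hk''.trans hk', h⟩

/-- The counter never decreases, so only indices from its present value on matter; before a target
is set, no index does. -/
theorem game_congr {prover' : ℕ → F.zk.Crs → Stmt n Attr → Wit lam → RO n (Option F.zk.Pf)}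
    {which' : ℕ → Bool → Bool} {p : Prog (ACQuery F m) ACQuery.Ans α} {e : Env F m}
    {s : TokenState F.pla m}
    (h : e.target = none ∨ ∀ k ≥ e.queries, prover k = prover' k ∧ which k = which' k) :
    game prover which p e s = game prover' which' p e s := by
  induction p generalizing e s with
  | ret a => rfl
  | ask q k ih =>
    have hq : acWith prover which q e = acWith prover' which' q e := by
      refine acOracle_congr _ _ fun hc => ?_
      rcases h with h | h
      · obtain ⟨_, _, _, _, _, ht, _⟩ := hc
        rw [h] at ht; cases ht
      · obtain ⟨h₁, h₂⟩ := h _ le_rfl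
        simp only [h₁, h₂, and_self]
    rw [game_ask, game_ask, ← hq]
    refine bind_congr_all (game_step_all q e s) fun r hr => ih _ ?_
    refine h.imp (fun h => hr.1.target.trans h) fun h k hk => h k ?_
    rw [hr.2] at hk
    omega
  | draw p k ih =>
    simp only [game, sim_draw] at ih ⊢
    congr; funext x; exact ih x h

/-- A choice that is not used, because the adversary makes too few queries, is irrelevant. -/
theorem wp_game_congr_of_atMost {which' : ℕ → Bool → Bool}
    {p : Prog (ACQuery F m) ACQuery.Ans α} {c q : ℕ} (hp : p.AtMost ACQuery.lrCost c)
    {e : Env F m} (hw : ∀ k < q, which k = which' k) (he : e.queries + c ≤ q)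
    (s : TokenState F.pla m) (f : ((α × Env F m) × TokenState F.pla m) → Table n → ℝ≥0∞)
    (t : Table n) :
    RO.wp (game prover which p e s) f t = RO.wp (game prover which' p e s) f t := by
  induction p generalizing e s t c with
  | ret a => rfl
  | ask i k ih =>
    have h1 : i.lrCost ≤ c := hp.1
    have hq : acWith prover which i e = acWith prover which' i e := by
      refine acOracle_congr _ _ fun hc => ⟨rfl, hw _ ?_⟩
      obtain ⟨_, _, _, _, rfl, _, _⟩ := hc
      simp only [ACQuery.lrCost] at h1
      omega
    rw [game_ask, game_ask, ← hq, RO.wp_bind, RO.wp_bind]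
    refine RO.wp_congr_all (game_step_all i e s) fun r t' hr => ?_
    exact ih r.1.1 (hp.2 r.1.1) (by rw [hr.2]; omega) _ _
  | draw p k ih =>
    refine tsum_congr fun x => ?_
    by_cases hx : x ∈ p.support
    · exact congrArg _ (ih x (hp x hx) he s t)
    -- The query bound says nothing about outcomes outside the support, but these have weight zero.
    -- For this reason expected values are compared here instead of programs.
    · rw [PMF.mem_support_iff, not_not] at hx
      rw [hx, zero_mul, zero_mul]

end

/-! ### Fresh nonces -/

theorem pmf_sum_of_support {β : Type} (p : PMF β) {g : β → ℝ≥0∞} {c : ℝ≥0∞}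
    (h : ∀ x ∈ p.support, g x = c) : ∑' x, p x * g x = c := by
  rw [← pmf_sum_const p c]
  refine tsum_congr fun x => ?_
  by_cases hx : x ∈ p.support
  · rw [h x hx]
  · rw [PMF.mem_support_iff, not_not] at hx
    rw [hx, zero_mul, zero_mul]

theorem salted_injective (d : Digest n) : Function.Injective (salted (lam := lam) d) := by
  intro r r' h
  exact List.ofFn_injective (List.append_cancel_left h)

/-- A uniformly random nonce hits a table of size `N` with probability at most `N / 2 ^ lam`. -/
theorem nonce_hit_le (d : Digest n) {t : Table n} {N : ℕ} (ht : t.Size N) :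
    ∑' r, PMF.uniformOfFintype (Nonce lam) r * (if t (salted d r) = none then 0 else 1) ≤
      (N : ℝ≥0∞) / 2 ^ lam := by
  obtain ⟨s, hs, hs'⟩ := ht
  rw [tsum_fintype]
  simp only [PMF.uniformOfFintype_apply, ← Finset.mul_sum]
  rw [ENNReal.div_eq_inv_mul]
  have hc : (Fintype.card (Nonce lam) : ℝ≥0∞) = 2 ^ lam := by simp [Nonce]
  rw [hc]
  refine mul_le_mul_right ?_ _
  -- Since salting is injective in the nonce, each of the at most `N` determined points is hit by at
  -- most one of the `2 ^ lam` nonces.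
  have : ∀ r : Nonce lam, (if t (salted d r) = none then (0 : ℝ≥0∞) else 1) ≤
      if salted d r ∈ s then 1 else 0 := by
    intro r
    by_cases h : salted d r ∈ s
    · simp only [h, if_true]; split <;> simp
    · simp [hs' _ h]
  refine (Finset.sum_le_sum fun r _ => this r).trans ?_
  rw [Finset.sum_boole]
  refine Nat.cast_le.2 (le_trans ?_ hs)
  exact Finset.card_le_card_of_injOn (salted d) (fun r hr => by simpa using hr)
    (salted_injective d).injOn

section

variable {α : Type} {rest : Digest n → RO n α} {t : Table n} {N : ℕ}

/-- Replacing the hash of a salted digest by a random digest lowers no expected value by more than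
the probability that the nonce is hit. -/
theorem wp_random_le_salted (d : Digest n)
    (hN : ∀ h, RO.Ends (rest h) t fun _ t' => t'.Size N) {f : α → ℝ≥0∞} (hf : ∀ a, f a ≤ 1) :
    ∑' h, PMF.uniformOfFintype (Digest n) h * RO.wp (rest h) (fun a _ => f a) t ≤
      ∑' r, PMF.uniformOfFintype (Nonce lam) r *
        RO.wp ((Prog.query (salted d r)).bind rest) (fun a _ => f a) t + N / 2 ^ lam := by
  -- For a fixed nonce whose point is undetermined, lazy sampling draws the digest and programs it
  -- there; runs that never touch this point keep their weight. If the point was already determined,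
  -- the left side is zero.
  have h1 : ∀ r : Nonce lam, ∑' h, PMF.uniformOfFintype (Digest n) h *
      RO.wp (rest h) (fun a t' => if t' (salted d r) = none then f a else 0) t ≤
      RO.wp ((Prog.query (salted d r)).bind rest) (fun a _ => f a) t := by
    intro r
    rw [query_bind]
    cases hr : t (salted d r) with
    | some y =>
      refine le_trans (le_of_eq (ENNReal.tsum_eq_zero.2 fun h => ?_)) zero_le
      rw [RO.wp_eq_zero_of_determined _ (by simp [hr]), mul_zero]
    | none =>
      rw [RO.wp_ask_none hr]
      exact ENNReal.tsum_le_tsum fun h => mul_le_mul_right (RO.wp_program_le _ _ _ _ _) _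
  -- Here the nonce is drawn after the run, independently of it, so it hits the final table with
  -- probability at most `N / 2 ^ lam`.
  have h2 : ∀ h, RO.wp (rest h) (fun a _ => f a) t ≤
      ∑' r : Nonce lam, PMF.uniformOfFintype (Nonce lam) r *
        RO.wp (rest h) (fun a t' => if t' (salted d r) = none then f a else 0) t +
          N / 2 ^ lam := by
    intro h
    rw [← RO.wp_sum]
    refine RO.wp_le (hN h) fun a t' ht' => ?_
    refine le_trans ?_ (add_le_add_right (nonce_hit_le d ht') _)
    rw [← ENNReal.tsum_add]
    conv_lhs => rw [← pmf_sum_const (PMF.uniformOfFintype (Nonce lam)) (f a)]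
    refine ENNReal.tsum_le_tsum fun r => ?_
    rw [← mul_add]
    refine mul_le_mul_right ?_ _
    split
    · simp
    · simpa using hf a
  calc _ ≤ ∑' h, PMF.uniformOfFintype (Digest n) h *
        (∑' r : Nonce lam, PMF.uniformOfFintype (Nonce lam) r *
        RO.wp (rest h) (fun a t' => if t' (salted d r) = none then f a else 0) t +
          N / 2 ^ lam) := ENNReal.tsum_le_tsum fun h => mul_le_mul_right (h2 h) _
    -- The averages over digest and nonce are interchanged, which puts the draw of the nonce back in
    -- front of the run. The error is constant and comes out of the average.
    _ = ∑' r : Nonce lam, PMF.uniformOfFintype (Nonce lam) r *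
        (∑' h, PMF.uniformOfFintype (Digest n) h *
        RO.wp (rest h) (fun a t' => if t' (salted d r) = none then f a else 0) t) +
          N / 2 ^ lam := by
      simp only [mul_add]
      rw [ENNReal.tsum_add, pmf_sum_const]
      simp only [← ENNReal.tsum_mul_left]
      rw [ENNReal.tsum_comm]
      simp only [mul_left_comm]
    _ ≤ _ := by
      gcongr with r
      exact h1 r

/-- The reverse bound needs no new coupling: the expected values of `f` and `1 - f` add up to one in
both games, so the previous inequality for `1 - f` is this one for `f`. -/
theorem wp_salted_le_random (d : Digest n)
    (hN : ∀ h, RO.Ends (rest h) t fun _ t' => t'.Size N) {f : α → ℝ≥0∞} (hf : ∀ a, f a ≤ 1) :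
    ∑' r, PMF.uniformOfFintype (Nonce lam) r *
        RO.wp ((Prog.query (salted d r)).bind rest) (fun a _ => f a) t ≤
    ∑' h, PMF.uniformOfFintype (Digest n) h * RO.wp (rest h) (fun a _ => f a) t +
      N / 2 ^ lam := by
  have key := wp_random_le_salted (lam := lam) d hN (f := fun a => 1 - f a)
    fun a => tsub_le_self
  have comp : ∀ (p : RO n α) (t : Table n),
      RO.wp p (fun a _ => f a) t + RO.wp p (fun a _ => 1 - f a) t = 1 := by
    intro p t
    rw [← RO.wp_add]
    simp only [add_tsub_cancel_of_le (hf _), RO.wp_const]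
  have e1 : ∑' h, PMF.uniformOfFintype (Digest n) h * RO.wp (rest h) (fun a _ => f a) t +
      ∑' h, PMF.uniformOfFintype (Digest n) h * RO.wp (rest h) (fun a _ => 1 - f a) t = 1 := by
    rw [← ENNReal.tsum_add]
    simp only [← mul_add, comp, pmf_sum_const]
  have e2 : ∑' r, PMF.uniformOfFintype (Nonce lam) r *
        RO.wp ((Prog.query (salted d r)).bind rest) (fun a _ => f a) t +
      ∑' r, PMF.uniformOfFintype (Nonce lam) r *
        RO.wp ((Prog.query (salted d r)).bind rest) (fun a _ => 1 - f a) t = 1 := by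
    rw [← ENNReal.tsum_add]
    simp only [← mul_add, comp, pmf_sum_const]
  have fin : ∑' h, PMF.uniformOfFintype (Digest n) h *
      RO.wp (rest h) (fun a _ => 1 - f a) t ≠ ⊤ :=
    ne_top_of_le_ne_top ENNReal.one_ne_top (le_add_self.trans e1.le)
  refine (ENNReal.add_le_add_iff_right fin).1 ?_
  refine (add_le_add_right key _).trans ?_
  rw [← add_assoc, e2, add_right_comm, e1]

end

/-! ### Issued credentials -/

/-- The credential was issued for the attributes `att`. -/
def Ask.Issued (att : Finset Attr) (a : Ask F) : Prop :=
  ∃ d ∈ (F.eid.issue att).support, a.dg = d.1 ∧ a.pk = d.2.1 ∧ a.sk = d.2.2 ∧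
    a.paSig ∈ (F.eid.paSign a.digest a.pk).support

theorem Ask.Issued.attrs {att : Finset Attr} {a : Ask F} (h : a.Issued att) :
    F.eid.attrs a.dg = att := by
  obtain ⟨d, hd, h, -⟩ := h
  rw [h, F.eid.attrs_issue att d hd]

/-- The environment of an experiment with policies and attributes `o`. -/
structure Env.Good (o : Setup (Srv := Srv) (Attr := Attr) m) (e : Env F m) : Prop where
  keys : (e.vk, e.sk) ∈ F.sig.keyGen.support
  issued : ∀ T, (e.ask T).Issued (o.att T)
  pol : e.pol = o.pol
  compliant : ∀ tgt, e.target = some tgt → o.Compliant tgt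

theorem Env.Good.frame {o : Setup (Srv := Srv) (Attr := Attr) m} {e e' : Env F m}
    (h : e.Good o) (hf : e.Frame e') : e'.Good o := by
  constructor
  · rw [hf.vk, hf.sk]; exact h.keys
  · rw [hf.ask]; exact h.issued
  · rw [hf.pol]; exact h.pol
  · rw [hf.target]; exact h.compliant

/-- With an issued credential, attestation succeeds, and the only trace of the credential is a
salted hash. -/
theorem wp_attested {vk : F.sig.VK} {sk : F.sig.SK} (hk : (vk, sk) ∈ F.sig.keyGen.support)
    {att : Finset Attr} {a : Ask F} (ha : a.Issued att) (c : Srv × List Bool)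
    (f : Nonce lam × AttMsg n Srv × Option F.sig.Sig → Table n → ℝ≥0∞) (t : Table n) :
    RO.wp (F.attested vk sk a c) f t = ∑' r, PMF.uniformOfFintype (Nonce lam) r *
      RO.wp (Prog.query (salted a.digest r)) (fun h t =>
        RO.wp (Prog.sample (F.sig.sign sk (h, c))) (fun s t => f (r, (h, c), some s) t) t) t := by
  obtain ⟨d, hd, -, hpk, hsk, hpa⟩ := ha
  simp only [Scheme.attested, Scheme.reqAttest, Scheme.attestChal, Scheme.attestResp,
    Scheme.attest, bind_eq, pure_eq, sample_bind, draw_bind, ret_bind, RO.wp_draw]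
  refine tsum_congr fun r => congrArg _ ?_
  -- Key exchange, command and chip response only decide whether the mediator signs. By correctness
  -- it does so for every value in their supports, so these draws drop out.
  refine pmf_sum_of_support _ fun key hkey => pmf_sum_of_support _ fun cmd hcmd =>
    pmf_sum_of_support _ fun resp hresp => ?_
  have h1 : F.eid.paVerify a.digest a.pk a.paSig = true := by
    rw [hpk] at hpa ⊢
    exact F.eid.pa_correct att d hd _ _ hpa
  have h2 : F.eid.caVerify resp key = true := by
    rw [hpk] at hkey
    rw [hsk] at hresp
    exact F.eid.ca_correct att d hd _ hk key hkey cmd hcmd resp hresp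
  simp only [h1, h2, Bool.and_self, if_true, bind_assoc, RO.wp_bind, draw_bind,
    ret_bind, RO.wp_draw, RO.wp_ret]
  rfl

theorem proveAC_eq {J : Type} {Q : J → Type}
    (prover : Stmt n Attr → Wit lam → Prog J Q (Option F.zk.Pf)) (att : AttMsg n Srv)
    (s : Option F.sig.Sig) (r : Nonce lam) (dg : List Bool) (pol : Finset Attr) :
    F.proveAC prover att s r dg pol =
      (if pol ⊆ F.eid.attrs dg then prover (att.1, pol) (dg, r) else .ret none).bind
        fun p => .ret (att, s, p) := by
  simp only [Scheme.proveAC, bind_eq, pure_eq, ite_bind]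

/-- A client run with a prover that ignores the witness, after the salted hash `h` was computed. -/
def simulatedClient (P : Stmt n Attr → RO n (Option F.zk.Pf)) (sk : F.sig.SK)
    (c : Srv × List Bool) (pol : Finset Attr) (b : Prop) [Decidable b] (h : Digest n) : RO n F.Proof :=
  (Prog.sample (F.sig.sign sk (h, c))).bind fun s =>
    (if b then P (h, pol) else .ret none).bind fun p => .ret ((h, c), some s, p)

theorem simulatedClient_atMost {P : Stmt n Attr → RO n (Option F.zk.Pf)} {q : ℕ}
    (hP : ∀ s, (P s).AtMost (fun _ => 1) q) (sk : F.sig.SK)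
    (c : Srv × List Bool) (pol : Finset Attr) (b : Prop) [Decidable b] (h : Digest n) :
    (simulatedClient P sk c pol b h).AtMost (fun _ => 1) q := by
  refine AtMost.bind_le 0 q (atMost_sample _ _) (fun s => ?_) (by omega)
  exact AtMost.bind_le q 0 (atMost_ite (hP _) (atMost_ret _ _)) (fun _ => atMost_ret _ _) le_rfl

section

variable {prover : ℕ → F.zk.Crs → Stmt n Attr → Wit lam → RO n (Option F.zk.Pf)}
  {o : Setup (Srv := Srv) (Attr := Attr) m}

/-- The credential that `which` selects occurs on the right only in the argument of the salted hash.
Everything after that query is common to both credentials, which is the form in which the digest can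
be randomised. -/
theorem wp_lr_simulated {P : F.zk.Crs → Stmt n Attr → RO n (Option F.zk.Pf)} {k : ℕ}
    (hk : ∀ crs s w, prover k crs s w = P crs s)
    {which : ℕ → Bool → Bool} {side : Bool} {cid : F.pla.Cid} {cp : F.PolChal} {e : Env F m}
    {tgt : Target m Srv} (ht : e.target = some tgt) (hp : cp.2 = e.pol (tgt.S side))
    (hq : e.queries = k) (hg : e.Good o) (s : TokenState F.pla m)
    (f : ((F.TokenOut × Env F m) × TokenState F.pla m) → Table n → ℝ≥0∞) (t : Table n) :
    RO.wp ((acWith prover which (.lr side cid (.inr cp)) e).sim coreOracle s) f t =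
      ∑' r, PMF.uniformOfFintype (Nonce lam) r *
        RO.wp ((Prog.query (salted (e.ask (tgt.T (which k side))).digest r)).bind fun h =>
          (simulatedClient (P e.crs) e.sk cp.1 cp.2 (cp.2 ⊆ o.att (tgt.T false)) h).bind fun p =>
            (lrTail side cid cp tgt e p).sim coreOracle s) f t := by
  -- Compliance enters here: whether a proof is produced or `⊥` is decided by the first token,
  -- whichever credential is used.
  have hatt : (cp.2 ⊆ F.eid.attrs (e.ask (tgt.T (which k side))).dg) ↔
      cp.2 ⊆ o.att (tgt.T false) := by
    rw [(hg.issued _).attrs, hp, hg.pol]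
    have := hg.compliant tgt ht side
    cases which k side
    · rfl
    · exact this.symm
  rw [acWith_lr ht hp, sim_bind, coreOracle_hash, bind_assoc, RO.wp_bind, hq,
    wp_attested hg.keys (hg.issued _)]
  refine tsum_congr fun r => congrArg _ ?_
  rw [RO.wp_bind]
  congr 1
  funext h t
  simp only [simulatedClient, bind_assoc, RO.wp_bind (Prog.sample _)]
  congr 1
  funext σ t
  simp only [ret_bind, sim_bind, coreOracle_hash, bind_assoc, proveAC_eq, hk, hatt]

theorem lrTail_all (side : Bool) (cid : F.pla.Cid) (cp : F.PolChal) (tgt : Target m Srv)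
    (e : Env F m) (p : F.Proof) (s : TokenState F.pla m) :
    ((lrTail side cid cp tgt e p).sim coreOracle s).All
      fun r => e.Frame r.1.2 ∧ r.1.2.queries = e.queries + 1 := by
  refine All.sim_result (post := fun r : F.TokenOut × Env F m =>
    e.Frame r.2 ∧ r.2.queries = e.queries + 1) ?_ _ _
  exact all_bind_of_forall fun d => all_bind_of_forall fun M => all_bind_of_forall fun a =>
    ⟨⟨rfl, rfl, rfl, rfl, rfl, rfl⟩, rfl⟩

/-- If the proof in the `k`-th query to `Left` and `Right` is simulated, the adversary does not
notice which credential is used there, unless a nonce is hit. -/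
theorem wp_game_swap_le {P : F.zk.Crs → Stmt n Attr → RO n (Option F.zk.Pf)} {k : ℕ}
    (hprover : ∀ k crs s w, (prover k crs s w).AtMost (fun _ => 1) F.zk.qProve)
    (hk : ∀ crs s w, prover k crs s w = P crs s) {which which' : ℕ → Bool → Bool}
    (hw : ∀ k' ≠ k, which k' = which' k') {α : Type} {p : Prog (ACQuery F m) ACQuery.Ans α}
    {c M N : ℕ} (hp : p.AtMost ACQuery.hashCost c) {e : Env F m} (hg : e.Good o)
    (s : TokenState F.pla m) {t : Table n} (ht : t.Size M) (hN : M + c ≤ N)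
    {f : ((α × Env F m) × TokenState F.pla m) → ℝ≥0∞} (hf : ∀ a, f a ≤ 1) :
    RO.wp (game prover which p e s) (fun a _ => f a) t ≤
      RO.wp (game prover which' p e s) (fun a _ => f a) t + (N / 2 ^ lam + N / 2 ^ lam) := by
  induction p generalizing c M e s t with
  | ret a => exact le_self_add
  | draw p k ih =>
    -- The draw is regarded as a program of its own, so that membership in the support becomes its
    -- postcondition.
    refine RO.wp_le (p := Prog.draw p .ret) 
      (f := fun x t => RO.wp (game prover which (k x) e s) (fun a _ => f a) t)
      (g := fun x t => RO.wp (game prover which' (k x) e s) (fun a _ => f a) t)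
      (post := fun x t' => x ∈ p.support ∧ t'.Size M) (fun x hx => ⟨hx, ht⟩) fun x t' hx => ?_
    exact ih x (hp x hx.1) hg s hx.2 hN
  | ask q kont ih =>
    have hc : q.hashCost ≤ c := hp.1
    by_cases hq : q.RunsClient e ∧ e.queries = k
    swap
    · have heq : acWith prover which q e = acWith prover which' q e :=
        acOracle_congr _ _ fun h => ⟨rfl, hw _ fun h' => hq ⟨h, h'⟩⟩
      rw [game_ask, game_ask, ← heq, RO.wp_bind, RO.wp_bind]
      have hs : ((acWith prover which q e).sim coreOracle s).AtMost (fun _ => 1) q.hashCost :=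
        (Spends.sim (acWith_atMost hprover which q e) coreOracle_atMost le_rfl s).mono
          fun _ _ _ => trivial
      refine RO.wp_le ((RO.Ends.of_all (game_step_all q e s) t).and
        (RO.Ends.of_spends (hs.spends hc) ht hN)) fun r t' hr => ?_
      obtain ⟨hfr, c', M', hc', hM', hN'⟩ := hr
      exact ih r.1.1 (hp.2 r.1.1) (hg.frame hfr.1) r.2 hM' (by omega)
    · obtain ⟨⟨side, cid, cp, tgt, rfl, htg, hpol⟩, hq⟩ := hq
      have hc2 : 2 + F.zk.qProve ≤ c := hc
      rw [game_ask, game_ask, RO.wp_bind, RO.wp_bind, wp_lr_simulated hk htg hpol hq hg,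
        wp_lr_simulated hk htg hpol hq hg]
      -- After the `k`-th query the counter exceeds `k`, and the two selections agree from there on.
      have hcont : ∀ (r : (F.TokenOut × Env F m) × TokenState F.pla m) (t' : Table n),
          (e.Frame r.1.2 ∧ r.1.2.queries = e.queries + 1) →
          RO.wp (game prover which (kont r.1.1) r.1.2 r.2) (fun a _ => f a) t' =
          RO.wp (game prover which' (kont r.1.1) r.1.2 r.2) (fun a _ => f a) t' := by
        intro r t' hr
        rw [game_congr (which' := which') (Or.inr fun k' hk' => ⟨rfl, hw k' ?_⟩)]
        omega
      let rest : Digest n → RO n ((α × Env F m) × TokenState F.pla m) := fun h =>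
        (simulatedClient (P e.crs) e.sk cp.1 cp.2 (cp.2 ⊆ o.att (tgt.T false)) h).bind fun p =>
          ((lrTail side cid cp tgt e p).sim coreOracle s).bind fun r =>
            game prover which (kont r.1.1) r.1.2 r.2
      have hrest : ∀ h, RO.Ends (rest h) t fun _ t' => t'.Size N := by
        intro h
        -- The `2` in the price pays for the salted hash and for the hash of `Π_Att`. Only the
        -- latter belongs to `rest`, so the budget `c` even has one unit to spare.
        have : (rest h).AtMost (fun _ => 1) c := by
          refine AtMost.bind_le F.zk.qProve (1 + (c - (2 + F.zk.qProve)))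
            (simulatedClient_atMost (fun s => ?_) _ _ _ _ _) (fun p => ?_) (by omega)
          · rw [← hk _ _ (([] : List Bool), fun _ => false)]
            exact hprover _ _ _ _
          · refine AtMost.bind (lrTail_atMost _ _ _ _ _ _ _) fun r => ?_
            exact (game_spends hprover (hp.2 r.1.1) le_rfl _ _).mono fun _ _ _ => trivial
        refine (RO.Ends.of_spends this ht hN).mono fun _ t' => ?_
        rintro ⟨c', M', -, ⟨S, hS, hS'⟩, h⟩
        exact ⟨S, by omega, hS'⟩
      -- Two hops, each costing `N / 2 ^ lam`: from the first credential to a random digest, and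
      -- from there to the second credential. The same `rest` serves both.
      refine (wp_salted_le_random (lam := lam) (e.ask (tgt.T (which k side))).digest (rest := rest) hrest
        hf |> le_trans (le_of_eq ?_)).trans ?_
      · refine tsum_congr fun r => ?_
        simp only [rest, RO.wp_bind]
      · rw [← add_assoc]
        refine add_le_add_left ?_ _
        refine (wp_random_le_salted (lam := lam) (e.ask (tgt.T (which' k side))).digest
          (rest := rest) hrest hf).trans (le_of_eq ?_)
        congr 1
        refine tsum_congr fun r => congrArg _ ?_
        simp only [rest, RO.wp_bind]
        congr 1
        funext h t
        congr 1
        funext p t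
        exact RO.wp_congr_all (lrTail_all _ _ _ _ _ p s) fun a t' ha => hcont a t' ha

end

/-! ### The zero-knowledge adversary -/

/-- The hash function is determined on the data groups of all tokens. -/
def Env.Hashed (e : Env F m) (t : Table n) : Prop := ∀ T, t (e.ask T).dg = some (e.ask T).digest

theorem Env.Hashed.frame {e e' : Env F m} {t t' : Table n} (h : e.Hashed t) (hf : e.Frame e')
    (ht : t.Le t') : e'.Hashed t' := by
  intro T
  rw [hf.ask]
  exact ht _ _ (h T)

/-- Both hash values are already determined, so the challenger's check neither fails nor extends the
table. It can be erased from the experiment. -/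
theorem wp_relation {attrs : List Bool → Finset Attr} {s : Stmt n Attr} {w : Wit lam}
    {t : Table n} {h : Digest n} (h₁ : t w.1 = some h) (h₂ : t (salted h w.2) = some s.1)
    (h₃ : s.2 ⊆ attrs w.1) (f : Bool → Table n → ℝ≥0∞) :
    RO.wp (relation attrs s w) f t = f true t := by
  simp only [relation, bind_eq, pure_eq, query_bind]
  rw [RO.wp_ask_some h₁, RO.wp_ask_some h₂, RO.wp_ret]
  simp [h₃]

theorem attested_ends (vk : F.sig.VK) (sk : F.sig.SK) (a : Ask F) (c : Srv × List Bool)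
    (t : Table n) :
    RO.Ends (F.attested vk sk a c) t fun r t' => t' (salted a.digest r.1) = some r.2.1.1 := by
  simp only [Scheme.attested, Scheme.reqAttest, Scheme.attestChal, Scheme.attestResp,
    Scheme.attest, bind_eq, pure_eq, sample_bind, draw_bind, ret_bind, bind_assoc]
  intro r _ key _ cmd _ resp _
  refine RO.Ends.bind (p := Prog.query (salted a.digest r))
    (mid := fun h t' => t' (salted a.digest r) = some h)
    ⟨fun y hy => hy, fun _ y => Function.update_self ..⟩ fun h t' hh => ?_
  split
  · exact fun s _ => hh
  · exact hh

/-- Run a phase of the adversary against zero-knowledge, with the tokens and the challenger. -/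
def zkGame (P : Stmt n Attr → Wit lam → RO n (Option F.zk.Pf)) (k : ℕ) (which : ℕ → Bool → Bool)
    {α : Type} (p : Prog (ACQuery F m) ACQuery.Ans α) (e : Env F m)
    (s : TokenState F.pla m) (v : Option Bool) :
    RO n (((α × Env F m) × TokenState F.pla m) × Option Bool) :=
  ((p.sim (acHybrid k which) e).sim hybridOracle s).sim (zkOracle F.eid.attrs P) v

section

variable {P : Stmt n Attr → Wit lam → RO n (Option F.zk.Pf)} {k : ℕ} {which : ℕ → Bool → Bool}
  {α : Type}

theorem zkGame_ask (q : ACQuery F m) (kont : q.Ans → Prog (ACQuery F m) ACQuery.Ans α)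
    (e : Env F m) (s : TokenState F.pla m) (v : Option Bool) :
    zkGame P k which (.ask q kont) e s v =
      (((acHybrid k which q e).sim hybridOracle s).sim (zkOracle F.eid.attrs P) v).bind
        fun r => zkGame P k which (kont r.1.1.1) r.1.1.2 r.1.2 r.2 := by
  simp only [zkGame, sim_ask, sim_bind]

theorem zkOracle_core_hash (p : RO n α) (s : TokenState F.pla m) (v : Option Bool) :
    ((p.via fun x => (Prog.query (HybridQuery.core (.hash x)) :
      Prog (HybridQuery F m) HybridQuery.Ans (Digest n))).sim hybridOracle s).sim
      (zkOracle F.eid.attrs P) v = p.bind fun a => .ret ((a, s), v) := by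
  have := zkOracle_core P (p.via (coreHash F m)) s v
  rw [via_via, coreOracle_hash] at this
  simpa only [query_via, bind_assoc, ret_bind] using this

theorem zkOracle_query_submit (st : Stmt n Attr) (w : Wit lam)
    (kont : Option F.zk.Pf → Prog (HybridQuery F m) HybridQuery.Ans α) (s : TokenState F.pla m) :
    ((Prog.bind (Prog.query (HybridQuery.submit st w)) kont).sim hybridOracle s).sim
      (zkOracle F.eid.attrs P) none =
    (relation F.eid.attrs st w).bind fun b => (P st w).bind fun p =>
      ((kont p).sim hybridOracle s).sim (zkOracle F.eid.attrs P) (some b) := by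
  change Prog.bind (Prog.bind (relation F.eid.attrs st w) fun b => (P st w).bind fun p =>
    .ret (p, some b)) (fun r : Option F.zk.Pf × Option Bool =>
      ((kont r.1).sim hybridOracle s).sim (zkOracle F.eid.attrs P) r.2) = _
  simp only [bind_assoc, ret_bind]

/-- Before Phase 2 is over, nothing is submitted. -/
theorem zkGame_phase1 {prover : ℕ → F.zk.Crs → Stmt n Attr → Wit lam → RO n (Option F.zk.Pf)}
    {which' : ℕ → Bool → Bool} (p : Prog (ACQuery F m) ACQuery.Ans α) {e : Env F m}
    (he : e.target = none) (s : TokenState F.pla m) (v : Option Bool) :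
    zkGame P k which p e s v = (game prover which' p e s).bind fun r => .ret (r, v) := by
  induction p generalizing e s with
  | ret a => rfl
  | ask q kont ih =>
    have hq : ¬ q.RunsClient e := by
      rintro ⟨_, _, _, _, _, ht, _⟩
      rw [he] at ht; cases ht
    rw [zkGame_ask, game_ask, acHybrid_eq_via (prover := prover) fun h => absurd h hq,
      zkOracle_core, show acWith prover which q e = acWith prover which' q e from
        acOracle_congr _ _ fun h => absurd h hq]
    simp only [bind_assoc, ret_bind]
    exact bind_congr_all (game_step_all q e s) fun r hr => ih _ (hr.1.target.trans he) _
  | draw p kont ih =>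
    simp only [zkGame, game, sim_draw] at ih ⊢
    simp only [draw_bind]
    congr; funext x; exact ih x he s

/-- Whatever is submitted to the challenger is a true statement with a witness. -/
theorem wp_zkGame {prover : ℕ → F.zk.Crs → Stmt n Attr → Wit lam → RO n (Option F.zk.Pf)}
    (hne : ∀ k' ≠ k, prover k' = fun crs => F.zk.prove crs)
    (p : Prog (ACQuery F m) ACQuery.Ans α)
    {e : Env F m} (hk : prover k e.crs = P) (s : TokenState F.pla m) {v : Option Bool}
    (hv : v ≠ some false) (hv' : e.queries ≤ k → v = none) {t : Table n} (ht : e.Hashed t)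
    {f : (((α × Env F m) × TokenState F.pla m) × Option Bool) → Table n → ℝ≥0∞}
    {g : ((α × Env F m) × TokenState F.pla m) → Table n → ℝ≥0∞}
    (hfg : ∀ a e' s' v' t', e.Frame e' → v' ≠ some false → e'.Hashed t' →
      f (((a, e'), s'), v') t' = g ((a, e'), s') t') :
    RO.wp (zkGame P k which p e s v) f t = RO.wp (game prover which p e s) g t := by
  induction p generalizing e s v t with
  | ret a => exact hfg _ _ _ _ _ (Env.Frame.refl e) hv ht
  | draw p kont ih =>
    exact tsum_congr fun x => congrArg _ (ih x hk s hv hv' ht hfg)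
  | ask q kont ih =>
    rw [zkGame_ask, game_ask, RO.wp_bind, RO.wp_bind]
    by_cases hq : q.RunsClient e ∧ e.queries = k
    swap
    · rw [acHybrid_eq_via (prover := prover), zkOracle_core, RO.wp_bind]
      · refine RO.wp_congr ((RO.Ends.of_all (game_step_all q e s) t).and (RO.ends_le _ t))
          fun r t' ⟨hr, ht'⟩ => ?_
        refine ih r.1.1 (by rw [hr.1.crs]; exact hk) r.2 hv (fun h => hv' ?_)
          (ht.frame hr.1 ht') fun a e' s' v' t' hf => hfg _ _ _ _ _ (hr.1.trans hf)
        rw [hr.2] at h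
        omega
      · intro hc
        have : e.queries ≠ k := fun h => hq ⟨hc, h⟩
        exact ⟨this, hne _ this⟩
    · obtain ⟨⟨side, cid, cp, tgt, rfl, htg, hpol⟩, hq⟩ := hq
      obtain rfl := hv' hq.le
      -- From here on the counter exceeds `k`, so the requirement that nothing has been submitted
      -- yet is vacuous. `v` may be `none`, after a proof `⊥`, or `some true`.
      have hcont : ∀ p v t', v ≠ some false → t.Le t' →
          RO.wp ((((lrTail side cid cp tgt e p).via
            fun c => Prog.query (HybridQuery.core c)).sim hybridOracle s).sim
            (zkOracle F.eid.attrs P) v)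
            (fun r t => RO.wp (zkGame P k which (kont r.1.1.1) r.1.1.2 r.1.2 r.2) f t) t' =
          RO.wp ((lrTail side cid cp tgt e p).sim coreOracle s)
            (fun r t => RO.wp (game prover which (kont r.1.1) r.1.2 r.2) g t) t' := by
        intro p v t' hv ht'
        rw [zkOracle_core, RO.wp_bind]
        refine RO.wp_congr ((RO.Ends.of_all (lrTail_all side cid cp tgt e p s) t').and
          (RO.ends_le _ t')) fun r t'' ⟨hr, ht''⟩ => ?_
        refine ih r.1.1 (by rw [hr.1.crs]; exact hk) r.2 hv (fun h => ?_)
          (ht.frame hr.1 (RO.table_le_trans ht' ht'')) fun a e' s' v' t' hf =>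
            hfg _ _ _ _ _ (hr.1.trans hf)
        rw [hr.2] at h
        omega
      rw [acHybrid_lr htg hpol hq, acWith_lr htg hpol]
      simp only [sim_bind, zkOracle_core_hash, coreOracle_hash, bind_assoc, ret_bind, RO.wp_bind]
      refine RO.wp_congr ((attested_ends _ _ _ _ t).and (RO.ends_le _ t)) fun r t' ⟨hr, ht'⟩ => ?_
      simp only [proveAC_eq, hq, hk]
      split
      · rename_i hsub
        refine (congrArg (fun p => RO.wp p _ t') (zkOracle_query_submit _ _ _ _)).trans ?_
        simp only [sim_ret, RO.wp_bind, RO.wp_ret]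
        -- The digest of the data groups was determined when the credential was issued, the salted
        -- hash by the attestation just made.
        rw [wp_relation (ht' _ _ (ht _)) (by rw [← hq]; exact hr) hsub]
        refine RO.wp_congr (RO.ends_le _ t') fun p t'' ht'' => ?_
        exact hcont _ _ _ (by simp) (RO.table_le_trans ht' ht'')
      · simp only [ret_bind, sim_ret, RO.wp_ret]
        exact hcont _ _ _ (by simp) ht'

end

/-! ### Setup and Phase 1 -/

/-- In the setup phase no query to `Left` or `Right` is possible; with all costs zero, the whole
budget survives. -/
theorem RO.Ends.of_spends_zero {α : Type} {p : RO n α} {k : ℕ} {post : α → ℕ → Prop}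
    (hp : p.Spends (fun _ => 0) k post) (t : Table n) : RO.Ends p t fun a _ => post a k := by
  induction p generalizing t with
  | ret a => exact hp
  | ask x c ih => exact ⟨fun y _ => ih y (hp.2 y) _, fun _ y => ih y (hp.2 y) _⟩
  | draw p c ih => exact fun x hx => ih x (hp x hx) t

theorem RO.Ends.replicate {α : Type} {m : ℕ} {p : Fin m → RO n α} {Q : Fin m → α → Table n → Prop}
    (hQ : ∀ i a t t', t.Le t' → Q i a t → Q i a t') (hp : ∀ i t, RO.Ends (p i) t (Q i))
    (t : Table n) : RO.Ends (Prog.replicate m p) t fun f t' => ∀ i, Q i (f i) t' := by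
  induction m generalizing t with
  | zero => exact fun i => i.elim0
  | succ m ih =>
    refine RO.Ends.bind (hp 0 t) fun a t₁ ha => ?_
    refine RO.Ends.bind ((ih (fun i => hQ i.succ) (fun i => hp i.succ) t₁).and (RO.ends_le _ t₁))
      fun f t₂ hf => ?_
    intro i
    refine Fin.cases ?_ (fun i => ?_) i
    · exact hQ 0 a _ _ hf.2 ha
    · exact hf.1 i

theorem issCred_ends (att : Finset Attr) (t : Table n) :
    RO.Ends (F.issCred att) t fun a t' => a.Issued att ∧ t' a.dg = some a.digest := by
  intro d hd
  refine RO.Ends.bind (p := Prog.query d.1) (mid := fun h t' => t' d.1 = some h)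
    ⟨fun y hy => hy, fun _ y => Function.update_self ..⟩ fun h t' hh => ?_
  exact fun p hp => ⟨⟨d, hd, rfl, rfl, rfl, hp⟩, hh⟩

theorem runSetup_eq (A : ACAdversary F m) (crs : F.zk.Crs) :
    A.runSetup crs = .draw F.sig.keyGen fun k => (A.setup crs k.1).bind fun r =>
      (Prog.replicate m fun T => F.issCred (r.1.att T)).bind fun ask =>
      .ret (r, ⟨crs, k.1, k.2, r.1.pol, ask, ServerState.empty, fun _ => none, none,
        fun _ => 0, 0⟩) := rfl

theorem runSetup_ends (A : ACAdversary F m) (crs : F.zk.Crs) (t : Table n) :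
    RO.Ends (A.runSetup crs) t fun r t' => r.2.Good r.1.1 ∧ r.2.Hashed t' ∧ r.2.crs = crs ∧
      r.2.target = none ∧ r.2.queries = 0 := by
  rw [runSetup_eq]
  intro k hk
  refine RO.Ends.bind (mid := fun _ _ => True)
    (RO.Ends.of_all (all_of_forall fun _ => trivial) t) fun r t' _ => ?_
  refine RO.Ends.bind (RO.Ends.replicate (fun i a t t' hle h => ⟨h.1, hle _ _ h.2⟩)
    (fun T t => issCred_ends (r.1.att T) t) t') fun ask t'' h => ?_
  exact ⟨⟨hk, fun T => (h T).1, rfl, fun tgt h => by cases h⟩, fun T => (h T).2, rfl, rfl, rfl⟩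

theorem runSetup_spends {A : ACAdversary F m} {h q : ℕ} {crs : F.zk.Crs}
    {post : Setup (Srv := Srv) (Attr := Attr) m × A.State0 → ℕ → Prop}
    (hA : ∀ vk, (A.setup crs vk).Spends (fun _ => h) q post) :
    (A.runSetup crs).Spends (fun _ => h) (q + m * h) fun r c => ∃ c' ≤ c, post r.1 c' := by
  have hi : ∀ att, (F.issCred att).AtMost (fun _ => h) h := by
    intro att
    refine AtMost.bind_le 0 h (atMost_sample _ _) (fun d => ?_) (by omega)
    refine AtMost.bind_le h 0 (atMost_query _) (fun h => ?_) le_rfl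
    exact AtMost.bind_le 0 0 (atMost_sample _ _) (fun s => atMost_ret _ _) le_rfl
  rw [runSetup_eq]
  intro k _
  refine Spends.bind (Spends.frame (hA k.1) (m * h)) ?_
  rintro r _ ⟨c, rfl, hc⟩
  exact Spends.bind (Spends.replicate fun T => hi (r.1.att T)) fun ask c' hc' => ⟨c, hc', hc⟩

theorem game_ends_queries
    {prover : ℕ → F.zk.Crs → Stmt n Attr → Wit lam → RO n (Option F.zk.Pf)}
    {which : ℕ → Bool → Bool} {α : Type} {p : Prog (ACQuery F m) ACQuery.Ans α} {c : ℕ}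
    {post : α → ℕ → Prop} (hp : p.Spends ACQuery.lrCost c post) (e : Env F m)
    (s : TokenState F.pla m) (t : Table n) :
    RO.Ends (game prover which p e s) t
      fun r _ => ∃ c', post r.1.1 c' ∧ r.1.2.queries + c' ≤ e.queries + c := by
  induction p generalizing e s t c with
  | ret a => exact ⟨c, hp, le_rfl⟩
  | ask i k ih =>
    have h1 : i.lrCost ≤ c := hp.1
    rw [game_ask]
    refine RO.Ends.bind (RO.Ends.of_all (game_step_all i e s) t) fun r t' hr => ?_
    refine (ih r.1.1 (hp.2 r.1.1) r.1.2 r.2 t').mono ?_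
    rintro r' _ ⟨c', h, h'⟩
    exact ⟨c', h, by rw [hr.2] at h'; omega⟩
  | draw p k ih => exact fun x hx => ih x (hp x hx) e s t

/-- The experiment up to the choice of the adversary in Phase 2, for a given common reference
string. -/
def ACAdversary.preamble (A : ACAdversary F m) (crs : F.zk.Crs) :
    RO n (Target m Srv × A.State × Env F m × TokenState F.pla m) :=
  (Prog.replicate m fun _ => Prog.sample F.pla.gen).bind fun msk =>
    (A.runSetup crs).bind fun r =>
    (game (fun _ => F.zk.prove) (fun _ side => side) (A.phase1 r.1.1 r.1.2) r.2
      (TokenState.start msk)).bind fun r =>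
    .ret (r.1.1.1.1, r.1.1.2, { r.1.2 with target := some r.1.1.1.1 }, r.2)

/-- The rest of the experiment, with secret bit `b`. -/
def ACAdversary.finish (A : ACAdversary F m) (x : Level)
    (prover : ℕ → F.zk.Crs → Stmt n Attr → Wit lam → RO n (Option F.zk.Pf))
    (which : ℕ → Bool → Bool) (b : Bool)
    (r : Target m Srv × A.State × Env F m × TokenState F.pla m) : RO n Bool :=
  (game prover which (A.phase3 r.2.1) r.2.2.1 { r.2.2.2 with phase2 := some (r.1, b) }).bind
    fun r' => .ret (wins x r.1 r.2.2.2 r'.2 b r'.1.1)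

theorem preamble_ends (A : ACAdversary F m) (crs : F.zk.Crs) (t : Table n) :
    RO.Ends (A.preamble crs) t fun r t' => (∃ o, r.2.2.1.Good o) ∧ r.2.2.1.Hashed t' ∧
      r.2.2.1.crs = crs := by
  refine RO.Ends.bind (mid := fun _ _ => True)
    (RO.Ends.of_all (all_of_forall fun _ => trivial) t) fun msk t _ => ?_
  refine RO.Ends.bind (runSetup_ends A crs t) fun r t hr => ?_
  refine RO.Ends.bind ((RO.Ends.of_all (game_frame _ _ _) t).and (RO.ends_le _ t))
    fun r' t' hr' => ?_
  have hg := hr.1.frame hr'.1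
  refine ⟨⟨r.1.1, hg.keys, hg.issued, hg.pol, ?_⟩, fun T => hr.2.1.frame hr'.1 hr'.2 T,
    hr'.1.crs.trans hr.2.2.1⟩
  -- The choice of Phase 2 carries its own proof of compliance.
  rintro tgt ⟨⟩
  exact r'.1.1.1.2

/-- The invariant is table size plus budget left for Phase 3. The summand `m` pays for the one hash
of the data groups in each issued credential. -/
theorem preamble_ends_size {A : ACAdversary F m} {q : ℕ} (hA : A.Within 1 ACQuery.hashCost q)
    (crs : F.zk.Crs) {t : Table n} {M : ℕ} (ht : t.Size M) :
    RO.Ends (A.preamble crs) t fun r t' => ∃ c M', (A.phase3 r.2.1).AtMost ACQuery.hashCost c ∧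
      t'.Size M' ∧ M' + c ≤ M + m + q := by
  refine RO.Ends.bind (RO.Ends.of_spends (k := 0) (N := M)
    ((Spends.replicate (n := 0) fun _ => atMost_sample _ 0).mono fun _ _ _ => trivial)
    ht (by omega)) ?_
  rintro msk t ⟨_, M₁, -, ht, hM⟩
  refine RO.Ends.bind (RO.Ends.of_spends (runSetup_spends fun vk => hA crs vk) ht le_rfl) ?_
  rintro r t ⟨c, M₂, ⟨c', hc, h⟩, ht, hM'⟩
  refine RO.Ends.bind (RO.Ends.of_spends (game_spends (fun _ => F.zk.prove_le) h hc _ _) ht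
    le_rfl) ?_
  rintro r' t ⟨c₃, M₃, ⟨c₃', hc₃, h₃⟩, ht, hM₃⟩
  exact ⟨c₃', M₃, h₃, ht, by omega⟩

theorem preamble_ends_queries {A : ACAdversary F m} {q : ℕ} (hA : A.Within 0 ACQuery.lrCost q)
    (crs : F.zk.Crs) (t : Table n) :
    RO.Ends (A.preamble crs) t fun r _ => ∃ c, (A.phase3 r.2.1).AtMost ACQuery.lrCost c ∧
      r.2.2.1.queries + c ≤ q := by
  refine RO.Ends.bind (mid := fun _ _ => True)
    (RO.Ends.of_all (all_of_forall fun _ => trivial) t) fun msk t _ => ?_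
  refine RO.Ends.bind ((RO.Ends.of_spends_zero (runSetup_spends fun vk => hA crs vk) t).and
    (runSetup_ends A crs t)) ?_
  rintro r t ⟨⟨c, hc, h⟩, -, -, -, -, he⟩
  refine RO.Ends.bind (game_ends_queries h _ _ t) ?_
  rintro r' t' ⟨c', h', hc'⟩
  exact ⟨c', h', by show r'.1.2.queries + c' ≤ q; omega⟩

theorem within_lrCost {A : ACAdversary F m} {qL qR : ℕ} (hL : A.SideQueries false qL)
    (hR : A.SideQueries true qR) : A.Within 0 ACQuery.lrCost (qL + qR) := by
  have hc : ∀ i : ACQuery F m, (fun i : ACQuery F m =>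
      (match i with | .lr s _ _ => if s = false then 1 else 0 | _ => 0) +
      (match i with | .lr s _ _ => if s = true then 1 else 0 | _ => 0)) i = i.lrCost := by
    rintro (_ | _ | _ | _ | _ | _ | _ | _ | ⟨_ | _, _, _⟩) <;> rfl
  have hc := funext hc
  intro crs vk
  refine (Spends.add (hL crs vk) (hR crs vk)).mono ?_
  rintro r _ ⟨m₁, m₂, rfl, h₁, h₂⟩
  have := Spends.add h₁ h₂
  rw [← hc]
  refine this.mono ?_
  rintro r _ ⟨m₁, m₂, rfl, h₁, h₂⟩
  exact (Spends.add h₁ h₂).mono fun _ _ _ => trivial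

/-! ### The experiments -/

/-- The probability that the experiment returns `1` with secret bit `b`, when `which` selects the
credentials in `Left` and `Right`. -/
def ACAdversary.winProb (A : ACAdversary F m) (x : Level) (which : ℕ → Bool → Bool) (b : Bool) :
    ℝ≥0∞ :=
  RO.wp (F.zk.setup.bind fun crs => (A.preamble crs).bind
    (A.finish x (fun _ => F.zk.prove) which b)) (fun g _ => bit g) fun _ => none

/-- Setup and Phase 1 do not depend on the secret bit, so its draw can be moved to the front by
linearity. -/
theorem acUnl_prTrue (x : Level) (A : ACAdversary F m) :
    (acUnl x A).exec.prTrue = (∑' b, PMF.uniformOfFintype Bool b *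
      A.winProb x (fun _ side => xor b side) b).toReal := by
  rw [RO.prTrue_exec]
  congr 1
  simp only [ACAdversary.winProb, acUnl, ACAdversary.preamble, ACAdversary.finish, game,
    acHonest_eq, bind_eq, pure_eq, bind_assoc, ret_bind, RO.wp_bind, ← RO.wp_sum, sample_bind,
    RO.wp_draw]

theorem Rand.ev_eq_tsum {α : Type} (p : Rand α) (f : α → ℝ≥0∞) :
    p.ev f = ∑' a, p.toPMF a * f a := by
  induction p with
  | ret b =>
    simp only [Rand.ev_ret, Rand.toPMF, PMF.pure_apply]
    rw [tsum_eq_single b (by intro b' hb'; simp [hb'])]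
    simp
  | ask i => exact i.elim
  | draw p k ih =>
    simp only [Rand.ev_draw, ih, Rand.toPMF, PMF.bind_apply, ← ENNReal.tsum_mul_left,
      ← ENNReal.tsum_mul_right, mul_assoc]
    rw [ENNReal.tsum_comm]

theorem Rand.ev_sum {α ι : Type} (p : Rand α) (w : ι → ℝ≥0∞) (f : ι → α → ℝ≥0∞) :
    p.ev (fun a => ∑' i, w i * f i a) = ∑' i, w i * p.ev (f i) := by
  simp only [Rand.ev_eq_tsum, ← ENNReal.tsum_mul_left]
  rw [ENNReal.tsum_comm]
  simp only [mul_left_comm]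

theorem RO.wp_ev_comm {α β : Type} (p : RO n α) (R : Rand β) (f : β → α → Table n → ℝ≥0∞)
    (t : Table n) : RO.wp p (fun a t => R.ev fun b => f b a t) t = R.ev fun b => RO.wp p (f b) t := by
  simp only [Rand.ev_eq_tsum, RO.wp_sum]

theorem RO.wp_replicate_sample {α : Type} (p : PMF α) (m : ℕ)
    (f : (Fin m → α) → Table n → ℝ≥0∞) (t : Table n) :
    RO.wp (Prog.replicate m fun _ => Prog.sample p) f t =
      Rand.ev (Prog.replicate m fun _ => Prog.sample p) fun a => f a t := by
  rw [RO.wp, replicate_sample_sim, Rand.ev_bind]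
  rfl

/-- The simulation is perfect, only with unswapped credentials for both values of the bit. The `PLA`
experiment draws the token keys before the reference string and the FIDO-AC experiment after it; the
two draws are independent and commute. -/
theorem plaUnl_prTrue (x : Level) (A : ACAdversary F m) :
    (plaUnl x A.toPLA).prTrue = (∑' b, PMF.uniformOfFintype Bool b *
      A.winProb x (fun _ side => side) b).toReal := by
  rw [Rand.prTrue_eq]
  congr 1
  simp only [ACAdversary.winProb, plaUnl, ACAdversary.toPLA, ACAdversary.preamble,
    ACAdversary.finish, game, acHonest_eq, bind_eq, pure_eq, bind_assoc, ret_bind, RO.wp_bind,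
    sample_bind, RO.wp_replicate_sample, RO.wp_ev_comm, sim_bind, lazyHash_sim,
    forward_sim, Rand.ev_bind, sim_ret, Rand.ev_ret, Rand.ev_draw]
  simp only [RO.wp, ← Rand.ev_sum]
  rfl

/-! ### Hybrids -/

/-- The first `j` queries to `Left` and `Right` use the credential of the other token. -/
def swapped (j : ℕ) (k : ℕ) (side : Bool) : Bool := if k < j then !side else side

theorem winProb_congr {A : ACAdversary F m} {q : ℕ} (hA : A.Within 0 ACQuery.lrCost q) (x : Level)
    {which which' : ℕ → Bool → Bool} (hw : ∀ k < q, which k = which' k) (b : Bool) :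
    A.winProb x which b = A.winProb x which' b := by
  simp only [ACAdversary.winProb, RO.wp_bind]
  congr 1
  funext crs t
  refine RO.wp_congr (preamble_ends_queries hA crs t) fun r t' ⟨c, hc, hq⟩ => ?_
  rw [ACAdversary.finish, ACAdversary.finish, RO.wp_bind, RO.wp_bind]
  exact wp_game_congr_of_atMost hc hw hq _ _ t'

/-- The last submission makes sure that a run without an earlier one still counts: the empty policy
is satisfied by any data groups, so the statement is true. If an earlier one was made, it is
ignored, and the output is unaffected in either case. -/
theorem zkOracle_final {P : Stmt n Attr → Wit lam → RO n (Option F.zk.Pf)} {a : Ask F}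
    {t : Table n} (ht : t a.dg = some a.digest) {v : Option Bool} (hv : v ≠ some false)
    (r : Nonce lam) (b : Bool) :
    RO.wp (((Prog.query (ZKQuery.hash (salted a.digest r)) :
        Prog (ZKQuery n lam Attr) (ZKQuery.Ans F.zk.Pf) (Digest n)).bind fun y =>
      (Prog.query (ZKQuery.submit (y, ∅) (a.dg, r)) :
        Prog (ZKQuery n lam Attr) (ZKQuery.Ans F.zk.Pf) (Option F.zk.Pf)).bind fun _ =>
      .ret b).sim (zkOracle F.eid.attrs P) v) (fun r _ => bit (zkOutcome r)) t = bit b := by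
  have h1 : ∀ v, v ≠ some false →
      ((Prog.query (ZKQuery.hash (salted a.digest r)) :
        Prog (ZKQuery n lam Attr) (ZKQuery.Ans F.zk.Pf) (Digest n)).bind fun y =>
      (Prog.query (ZKQuery.submit (y, ∅) (a.dg, r)) :
        Prog (ZKQuery n lam Attr) (ZKQuery.Ans F.zk.Pf) (Option F.zk.Pf)).bind fun _ =>
      .ret b).sim (zkOracle F.eid.attrs P) v =
      (Prog.query (salted a.digest r)).bind fun y =>
        (zkOracle F.eid.attrs P (.submit (y, ∅) (a.dg, r)) v).bind fun r => .ret (b, r.2) :=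
    fun _ _ => rfl
  rw [h1 v hv, RO.wp_bind]
  refine (RO.wp_congr (g := fun _ _ => bit b) ((show RO.Ends (Prog.query (salted a.digest r)) t
    (fun y t' => t' (salted a.digest r) = some y) from
      ⟨fun y hy => hy, fun _ y => Function.update_self ..⟩).and (RO.ends_le _ t)) ?_).trans
    (RO.wp_const _ _ _)
  rintro y t' ⟨hy, ht'⟩
  match v, hv with
  | some true, _ => simp [zkOracle, zkOutcome]
  | none, _ =>
    simp only [zkOracle, bind_eq, pure_eq, Prog.bind_assoc, RO.wp_bind, ret_bind, RO.wp_ret]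
    rw [wp_relation (ht' _ _ ht) hy (Finset.empty_subset _)]
    simp [zkOutcome, RO.wp_const]

/-- The experiment for zero-knowledge, up to the setup of the proof system. -/
theorem wp_toZK (A : ACAdversary F m) (x : Level) {q : ℕ} [Nonempty (Fin q)] (hq : 0 < q)
    (crs : F.zk.Crs) (P : Stmt n Attr → Wit lam → RO n (Option F.zk.Pf))
    {prover : ℕ → ℕ → F.zk.Crs → Stmt n Attr → Wit lam → RO n (Option F.zk.Pf)}
    (hne : ∀ k, ∀ k' ≠ k, prover k k' = fun crs => F.zk.prove crs)
    (hk : ∀ k, prover k k crs = P) (t : Table n) :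
    RO.wp ((A.toZK x q crs).sim (zkOracle F.eid.attrs P) none) (fun r _ => bit (zkOutcome r)) t =
    ∑' k, PMF.uniformOfFintype (Fin q) k * ∑' d, PMF.uniformOfFintype Bool d *
      RO.wp ((A.preamble crs).bind (A.finish x (prover k) (swapped (k + d.toNat)) true))
        (fun g _ => bit (xor g d)) t := by
  simp only [ACAdversary.toZK, hq, dif_pos, bind_eq, pure_eq, sample_bind, sim_draw, RO.wp_draw]
  refine tsum_congr fun k => congrArg _ (tsum_congr fun d => congrArg _ ?_)
  -- The guess `d` decides between two neighbouring hybrids: the `k`-th query is swapped exactly if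
  -- `d = true`.
  have hw : (fun (k' : ℕ) (side : Bool) => if k' < k.1 ∨ (k' = k.1 ∧ d = true) then !side else side)
      = swapped (k + d.toNat) := by
    funext k' side
    unfold swapped
    congr 1
    cases d
    · simp
    · simp [← le_iff_lt_or_eq]
  rw [hw]
  simp only [ACAdversary.preamble, sim_bind, replicate_sample_sim, zkOracle_hash, Prog.bind_assoc,
    RO.wp_bind, ret_bind]
  congr 1
  funext msk t
  refine RO.wp_congr (runSetup_ends A crs t) fun r t ⟨hg, hh, hc, ht, _⟩ => ?_
  rw [← zkGame, zkGame_phase1 (prover := fun _ => F.zk.prove) (which' := fun _ side => side) _ ht]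
  simp only [RO.wp_bind, RO.wp_ret]
  refine RO.wp_congr ((RO.Ends.of_all (game_frame _ _ _) t).and (RO.ends_le _ t))
    fun r' t' ⟨hf, hle⟩ => ?_
  rw [← zkGame, ACAdversary.finish, RO.wp_bind]
  have hh' := hh.frame hf hle
  -- The reference string never changes, so agreement of the provers at `crs` alone suffices.
  have hP : prover k k r'.1.2.crs = P := by rw [← hk k, ← hc, ← hf.crs]
  refine wp_zkGame (P := P) (hne k) _ (e := { r'.1.2 with target := some r'.1.1.1.1 }) hP _ (by simp) (fun _ => rfl)
    (t := t') (fun T => hh' T) fun g e' s' v' t'' hf' hv' ht'' => ?_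
  have := zkOracle_final (P := P) (t := t'') (a := r'.1.2.ask (r'.1.1.1.1.T false)) ?_ hv'
    (fun _ => false) (wins x r'.1.1.1 r'.2 s' true g ^^ d)
  · simpa only [sim_bind, RO.wp_bind, RO.wp_ret] using this
  · have := ht'' (r'.1.1.1.1.T false)
    rwa [hf'.ask] at this

/-! ### Success of the zero-knowledge adversary with real and with simulated proofs -/

section

variable {σ : Type}

/-- The success probability of the zero-knowledge adversary, when the reference string and the
prover are chosen by `init`. -/
theorem toReal_wp_toZK (A : ACAdversary F m) (x : Level) {q : ℕ} (hq : 0 < q) (init : RO n σ)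
    (crs : σ → F.zk.Crs) (P : σ → Stmt n Attr → Wit lam → RO n (Option F.zk.Pf))
    {prover : σ → ℕ → ℕ → F.zk.Crs → Stmt n Attr → Wit lam → RO n (Option F.zk.Pf)}
    (hne : ∀ i k, ∀ k' ≠ k, prover i k k' = fun crs => F.zk.prove crs)
    (hk : ∀ i k, prover i k k (crs i) = P i) (t : Table n) :
    (RO.wp (init.bind fun i => (A.toZK x q (crs i)).sim (zkOracle F.eid.attrs (P i)) none)
      (fun r _ => bit (zkOutcome r)) t).toReal =
    1 / 2 + 1 / (2 * q) * ∑ k ∈ Finset.range q,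
      ((RO.wp (init.bind fun i => (A.preamble (crs i)).bind
        (A.finish x (prover i k) (swapped k) true)) (fun g _ => bit g) t).toReal -
      (RO.wp (init.bind fun i => (A.preamble (crs i)).bind
        (A.finish x (prover i k) (swapped (k + 1)) true)) (fun g _ => bit g) t).toReal) := by
  have : Nonempty (Fin q) := ⟨⟨0, hq⟩⟩
  let p : ℕ → ℕ → RO n Bool := fun k j => init.bind fun i => (A.preamble (crs i)).bind
    (A.finish x (prover i k) (swapped j) true)
  have hle : ∀ k j, RO.wp (p k j) (fun g _ => bit g) t ≤ 1 := fun k j =>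
    RO.wp_le_one fun g _ => bit_le_one g
  have hnot : ∀ k j, (RO.wp (p k j) (fun g _ => bit (!g)) t).toReal =
      1 - (RO.wp (p k j) (fun g _ => bit g) t).toReal := by
    intro k j
    have h : RO.wp (p k j) (fun g _ => bit g) t + RO.wp (p k j) (fun g _ => bit (!g)) t = 1 := by
      rw [← RO.wp_add]
      simp only [bit_add_not, RO.wp_const]
    have h1 := congrArg ENNReal.toReal h
    rw [ENNReal.toReal_add (ne_top_of_le_ne_top ENNReal.one_ne_top (hle k j))
      (ne_top_of_le_ne_top ENNReal.one_ne_top (RO.wp_le_one fun g _ => bit_le_one _)),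
      ENNReal.toReal_one] at h1
    linarith
  -- For `d = 1` the output is negated, so the success probability is the average over `k` of half
  -- of `p k k` plus half of the complement of `p k (k + 1)`. The complements contribute the
  -- constant 1/2.
  have key : RO.wp (init.bind fun i => (A.toZK x q (crs i)).sim (zkOracle F.eid.attrs (P i)) none)
      (fun r _ => bit (zkOutcome r)) t = ∑ k : Fin q, (q : ℝ≥0∞)⁻¹ *
        (2⁻¹ * RO.wp (p k k) (fun g _ => bit g) t +
          2⁻¹ * RO.wp (p k (k + 1)) (fun g _ => bit (!g)) t) := by
    rw [RO.wp_bind]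
    simp only [wp_toZK A x hq (crs _) (P _) (hne _) (hk _), RO.wp_sum]
    rw [tsum_fintype]
    have hp : ∀ k j (f : Bool → Table n → ℝ≥0∞), RO.wp (p k j) f t = RO.wp init (fun i t =>
      RO.wp ((A.preamble (crs i)).bind (A.finish x (prover i k) (swapped j) true)) f t) t :=
      fun _ _ _ => RO.wp_bind _ _ _ _
    refine Finset.sum_congr rfl fun k _ => ?_
    rw [tsum_bool]
    simp only [PMF.uniformOfFintype_apply, Fintype.card_fin, Fintype.card_bool, Bool.toNat_false,
      Bool.toNat_true, Bool.xor_false, Bool.xor_true, add_zero, hp, Nat.cast_ofNat]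
  have hq' : (q : ℝ) ≠ 0 := by exact_mod_cast hq.ne'
  rw [key, ENNReal.toReal_sum]
  · have hterm : ∀ k : Fin q, ((q : ℝ≥0∞)⁻¹ *
        (2⁻¹ * RO.wp (p k k) (fun g _ => bit g) t +
          2⁻¹ * RO.wp (p k (k + 1)) (fun g _ => bit (!g)) t)).toReal =
        1 / (2 * q) + 1 / (2 * q) * ((RO.wp (p k k) (fun g _ => bit g) t).toReal -
          (RO.wp (p k (k + 1)) (fun g _ => bit g) t).toReal) := by
      intro k
      rw [ENNReal.toReal_mul, ENNReal.toReal_add, ENNReal.toReal_mul, ENNReal.toReal_mul, hnot]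
      · simp only [ENNReal.toReal_inv, ENNReal.toReal_natCast, ENNReal.toReal_ofNat]
        field_simp
        ring
      · exact ENNReal.mul_ne_top (by simp) (ne_top_of_le_ne_top ENNReal.one_ne_top (hle _ _))
      · exact ENNReal.mul_ne_top (by simp) (ne_top_of_le_ne_top ENNReal.one_ne_top
          (RO.wp_le_one fun g _ => bit_le_one _))
    rw [Finset.sum_congr rfl fun k _ => hterm k, Finset.sum_add_distrib, ← Finset.mul_sum,
      Finset.sum_range]
    simp only [Finset.sum_const, Finset.card_univ, Fintype.card_fin, nsmul_eq_mul]
    congr 1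
    field_simp
  · intro k _
    refine ENNReal.mul_ne_top (by simpa using hq.ne') (ENNReal.add_ne_top.2 ⟨?_, ?_⟩)
    · exact ENNReal.mul_ne_top (by simp) (ne_top_of_le_ne_top ENNReal.one_ne_top (hle _ _))
    · exact ENNReal.mul_ne_top (by simp) (ne_top_of_le_ne_top ENNReal.one_ne_top
        (RO.wp_le_one fun g _ => bit_le_one _))

/-- With a simulated proof in the `k`-th query, the credential in this query is hidden. -/
theorem wp_simulated_le {A : ACAdversary F m} {q qH : ℕ} (hA : A.Within 1 ACQuery.hashCost q)
    (hqH : F.zk.qSetup + m + q ≤ qH) (x : Level) {init : RO n σ}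
    (hinit : init.AtMost (fun _ => 1) F.zk.qSetup)
    (crs : σ → F.zk.Crs) {P : σ → Stmt n Attr → RO n (Option F.zk.Pf)}
    {prover : σ → ℕ → F.zk.Crs → Stmt n Attr → Wit lam → RO n (Option F.zk.Pf)} {k : ℕ}
    (hprover : ∀ i k crs s w, (prover i k crs s w).AtMost (fun _ => 1) F.zk.qProve)
    (hk : ∀ i crs s w, prover i k crs s w = P i s) {which which' : ℕ → Bool → Bool}
    (hw : ∀ k' ≠ k, which k' = which' k') (b : Bool) :
    RO.wp (init.bind fun i => (A.preamble (crs i)).bind (A.finish x (prover i) which b))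
      (fun g _ => bit g) (fun _ => none) ≤
    RO.wp (init.bind fun i => (A.preamble (crs i)).bind (A.finish x (prover i) which' b))
      (fun g _ => bit g) (fun _ => none) + (qH / 2 ^ lam + qH / 2 ^ lam) := by
  rw [RO.wp_bind, RO.wp_bind]
  refine RO.wp_le (RO.Ends.of_spends hinit (M := 0) (N := F.zk.qSetup) ⟨∅, by simp, by simp⟩
    (by omega)) ?_
  rintro i t ⟨_, M, -, ht, hM⟩
  rw [RO.wp_bind, RO.wp_bind]
  refine RO.wp_le ((preamble_ends A (crs i) t).and (preamble_ends_size hA (crs i) ht)) ?_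
  rintro r t' ⟨⟨⟨o, hg⟩, -, -⟩, c, M', hc, ht', hM'⟩
  rw [ACAdversary.finish, ACAdversary.finish, RO.wp_bind, RO.wp_bind]
  exact wp_game_swap_le (P := fun _ => P i) (hprover i) (hk i) hw hc hg _ ht' (by omega)
    (f := fun a => bit (wins x r.1 r.2.2.2 a.2 b a.1.1)) fun a => bit_le_one _

theorem abs_toReal_sub_le {a b c : ℝ≥0∞} (ha : a ≤ 1) (hb : b ≤ 1) (hc : c ≠ ⊤)
    (hab : a ≤ b + c) (hba : b ≤ a + c) : |a.toReal - b.toReal| ≤ c.toReal := by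
  have ha' := ne_top_of_le_ne_top ENNReal.one_ne_top ha
  have hb' := ne_top_of_le_ne_top ENNReal.one_ne_top hb
  have h1 := ENNReal.toReal_mono (ENNReal.add_ne_top.2 ⟨hb', hc⟩) hab
  have h2 := ENNReal.toReal_mono (ENNReal.add_ne_top.2 ⟨ha', hc⟩) hba
  rw [ENNReal.toReal_add hb' hc] at h1
  rw [ENNReal.toReal_add ha' hc] at h2
  rw [abs_le]
  constructor <;> linarith

end

/-- Each `k` compares two neighbouring hybrids whose only difference lies in the query with the
simulated proof, hence by at most `2 * (qH / 2 ^ lam)`. Averaging over `k` with the prefactor `1 /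
(2 * q)` leaves `qH / 2 ^ lam`. -/
theorem zkSim_le (Sm : Simulator F.zk) {A : ACAdversary F m} (x : Level) {q qH : ℕ} (hq : 0 < q)
    (hH : A.HashQueries qH) :
    |(zkSim F.zk Sm F.eid.attrs (A.toZK x q)).exec.prTrue - 1 / 2| ≤ qH / 2 ^ lam := by
  obtain ⟨q', hA, hqH⟩ := hH
  -- All proofs but the `k`-th are honest, though under a simulated reference string. The games thus
  -- depend on `k`, and the sum is bounded term by term instead of telescoping.
  let prover : F.zk.Crs × Sm.Td → ℕ → ℕ → F.zk.Crs → Stmt n Attr → Wit lam →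
    RO n (Option F.zk.Pf) := fun i k k' crs =>
      if k' = k then fun s _ => Sm.sim2 i.1 s i.2 else F.zk.prove crs
  have hprover : ∀ i k k' crs s w, (prover i k k' crs s w).AtMost (fun _ => 1) F.zk.qProve := by
    intro i k k' crs s w
    simp only [prover]
    split
    · exact Sm.sim2_le _ _ _
    · exact F.zk.prove_le _ _ _
  have h0 : (zkSim F.zk Sm F.eid.attrs (A.toZK x q)).exec.prTrue =
      (RO.wp (Sm.sim1.bind fun i => (A.toZK x q i.1).sim
        (zkOracle F.eid.attrs fun s _ => Sm.sim2 i.1 s i.2) none)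
        (fun r _ => bit (zkOutcome r)) fun _ => none).toReal := by
    rw [RO.prTrue_exec]
    simp only [zkSim, bind_eq, pure_eq, RO.wp_bind, RO.wp_ret]
  rw [h0, toReal_wp_toZK A x hq Sm.sim1 Prod.fst (fun i s _ => Sm.sim2 i.1 s i.2)
    (prover := prover) (fun i k k' hk => by funext crs; simp [prover, hk])
    (fun i k => by simp [prover]), add_sub_cancel_left, abs_mul, abs_of_nonneg (by positivity)]
  have hq' : (0 : ℝ) < q := by exact_mod_cast hq
  have hterm : ∀ k, |(RO.wp (Sm.sim1.bind fun i => (A.preamble i.1).bind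
        (A.finish x (prover i k) (swapped k) true)) (fun g _ => bit g) fun _ => none).toReal -
      (RO.wp (Sm.sim1.bind fun i => (A.preamble i.1).bind
        (A.finish x (prover i k) (swapped (k + 1)) true)) (fun g _ => bit g)
          fun _ => none).toReal| ≤ 2 * (qH / 2 ^ lam) := by
    intro k
    have hw : ∀ k' ≠ k, swapped k k' = swapped (k + 1) k' := by
      intro k' hk'
      funext side
      simp only [swapped, show k' < k + 1 ↔ k' < k by omega]
    refine (abs_toReal_sub_le (RO.wp_le_one fun g _ => bit_le_one g)
      (RO.wp_le_one fun g _ => bit_le_one g) (c := qH / 2 ^ lam + qH / 2 ^ lam) ?_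
      (wp_simulated_le hA hqH x Sm.sim1_le Prod.fst (P := fun i s => Sm.sim2 i.1 s i.2)
        (fun i => hprover i k) (fun i crs s w => by simp [prover]) hw true)
      (wp_simulated_le hA hqH x Sm.sim1_le Prod.fst (P := fun i s => Sm.sim2 i.1 s i.2)
        (fun i => hprover i k) (fun i crs s w => by simp [prover])
        (fun k' hk' => (hw k' hk').symm) true)).trans (le_of_eq ?_)
    · simp [ENNReal.div_eq_top]
    · rw [ENNReal.toReal_add (by simp [ENNReal.div_eq_top]) (by simp [ENNReal.div_eq_top])]
      simp only [ENNReal.toReal_div, ENNReal.toReal_natCast, ENNReal.toReal_pow,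
        ENNReal.toReal_ofNat]
      ring
  refine (mul_le_mul_of_nonneg_left ((Finset.abs_sum_le_sum_abs _ _).trans
    (Finset.sum_le_sum fun k _ => hterm k)) (by positivity)).trans (le_of_eq ?_)
  simp only [Finset.sum_const, Finset.card_range, nsmul_eq_mul]
  field_simp

/-- With the honest prover at every position, the hybrids no longer depend on which proof was
requested from the challenger, and the sum telescopes. -/
theorem zkReal_eq (A : ACAdversary F m) (x : Level) {q : ℕ} (hq : 0 < q) :
    (zkReal F.zk F.eid.attrs (A.toZK x q)).exec.prTrue = 1 / 2 + 1 / (2 * q) *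
      ((A.winProb x (swapped 0) true).toReal - (A.winProb x (swapped q) true).toReal) := by
  have h0 : (zkReal F.zk F.eid.attrs (A.toZK x q)).exec.prTrue =
      (RO.wp (F.zk.setup.bind fun crs => (A.toZK x q crs).sim
        (zkOracle F.eid.attrs (F.zk.prove crs)) none)
        (fun r _ => bit (zkOutcome r)) fun _ => none).toReal := by
    rw [RO.prTrue_exec]
    simp only [zkReal, bind_eq, pure_eq, RO.wp_bind, RO.wp_ret]
  refine h0.trans ((toReal_wp_toZK A x hq F.zk.setup (fun crs => crs) F.zk.prove
    (prover := fun _ _ _ => F.zk.prove) (fun i k k' hk => rfl) (fun i k => rfl) _).trans ?_)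
  congr 2
  exact Finset.sum_range_sub' (fun k => (A.winProb x (swapped k) true).toReal) q

end FidoAC

end

/-! ### The bound on the advantage -/

open FidoAC in
theorem mainTheorem2 {n lam m : ℕ} {Srv Attr : Type} (F : Scheme n lam Srv Attr)
    (Sm : Simulator F.zk) (x : Level) (A : ACAdversary F m) (qH qL qR : ℕ)
    (hH : A.HashQueries qH) (hL : A.SideQueries false qL) (hR : A.SideQueries true qR) :
    acUnlAdvantage x A ≤ plaUnlAdvantage x A.toPLA +
      ((qL : ℝ) + qR) * (qH / 2 ^ lam + zkAdvantage F.zk Sm F.eid.attrs (A.toZK x (qL + qR))) := by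
  have hlr := within_lrCost hL hR
  have hle : ∀ which b, A.winProb x which b ≠ ⊤ := fun which b =>
    ne_top_of_le_ne_top ENNReal.one_ne_top (RO.wp_le_one fun g _ => bit_le_one g)
  have avg : ∀ w : Bool → ℕ → Bool → Bool, (∑' b, PMF.uniformOfFintype Bool b *
      A.winProb x (w b) b).toReal = ((A.winProb x (w false) false).toReal +
        (A.winProb x (w true) true).toReal) / 2 := by
    intro w
    rw [tsum_bool]
    simp only [PMF.uniformOfFintype_apply, Fintype.card_bool]
    rw [ENNReal.toReal_add (ENNReal.mul_ne_top (by simp) (hle _ _))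
      (ENNReal.mul_ne_top (by simp) (hle _ _)), ENNReal.toReal_mul, ENNReal.toReal_mul]
    simp only [ENNReal.toReal_inv, Nat.cast_ofNat, ENNReal.toReal_ofNat]
    ring
  have hz : swapped 0 = fun _ side => side := by
    funext k side
    simp [swapped]
  -- The last hybrid and the complete swap differ only at indices that the adversary never reaches.
  have hq : A.winProb x (swapped (qL + qR)) true = A.winProb x (fun _ side => !side) true :=
    winProb_congr hlr x (fun k hk => by funext side; simp [swapped, hk]) true
  have hac : (acUnl x A).exec.prTrue = ((A.winProb x (swapped 0) false).toReal +
      (A.winProb x (swapped (qL + qR)) true).toReal) / 2 := by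
    rw [acUnl_prTrue, avg fun b _ side => xor b side, hq, hz]
    simp only [Bool.false_xor, Bool.true_xor]
  have hpla : (plaUnl x A.toPLA).prTrue = ((A.winProb x (swapped 0) false).toReal +
      (A.winProb x (swapped 0) true).toReal) / 2 := by
    rw [plaUnl_prTrue, avg fun _ _ side => side, hz]
  rw [acUnlAdvantage, plaUnlAdvantage]
  have hsplit : |(acUnl x A).exec.prTrue - 1 / 2| ≤ |(plaUnl x A.toPLA).prTrue - 1 / 2| +
      |(acUnl x A).exec.prTrue - (plaUnl x A.toPLA).prTrue| := by
    rw [add_comm]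
    exact abs_sub_le _ _ _
  refine hsplit.trans (add_le_add_right ?_ _)
  have hcast : ((qL : ℝ) + qR) = ((qL + qR : ℕ) : ℝ) := by push_cast; rfl
  rw [hcast]
  generalize qL + qR = q at *
  -- Without queries to `Left` and `Right` there is no position to guess, but then the first and the
  -- last hybrid coincide.
  rcases Nat.eq_zero_or_pos q with rfl | hpos
  · rw [hac, hpla]
    simp
  have hq' : (0 : ℝ) < q := by exact_mod_cast hpos
  -- The terms with secret bit 0 cancel. The average over the bit leaves a factor 1/2 and
  -- `zkReal_eq` has `1 / (2 * q)`, so the ratio is exactly `q`.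
  have hdiff : (acUnl x A).exec.prTrue - (plaUnl x A.toPLA).prTrue =
      -(q * ((zkReal F.zk F.eid.attrs (A.toZK x q)).exec.prTrue - 1 / 2)) := by
    rw [hac, hpla, zkReal_eq A x hpos]
    field_simp
    ring
  rw [hdiff, abs_neg, abs_mul, abs_of_pos hq']
  refine mul_le_mul_of_nonneg_left ?_ hq'.le
  rw [add_comm]
  -- The triangle inequality goes through the experiment with simulated proofs.
  exact (abs_sub_le _ _ _).trans (add_le_add_right (zkSim_le Sm x hpos hH) _)
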